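/- Notation. Let $I=[-1,1]$, $\alpha\ge -\tfrac12$, $\omega(x)=(1-x^2)^{\alpha}$, $\|g\|_\omega=\big(\int_{-1}^1|g(x)|^2\omega(x)\,dx\big)^{1/2}$, let $\|g\|_\infty$ be the (essential) supremum of $|g|$ over $I$, and let $\gamma_{\alpha,\alpha}=\int_{-1}^1\omega(x)\,dx=2^{2\alpha+1}B(\alpha+1,\alpha+1)$. Let $\widetilde P_k$ $(k\ge 0)$ be the Jacobi polynomials with both parameters equal to $\alpha$, normalized by $\|\widetilde P_k\|_\omega=1$. Let $X_1,\dots,X_n$ be i.i.d. random variables with density $\omega/\gamma_{\alpha,\alpha}$ on $I$ (the beta distribution $B(\alpha+1,\alpha+1)$ over $I$), and let $Y_i=f(X_i)+\varepsilon_i$, $1\le i\le n$, where $\varepsilon_1,\dots,\varepsilon_n$ are real random variables; put $\pmb\eta_n=\max_{1\le i\le n}|\varepsilon_i|$. For $N+1\le n$ let $B_N=\big[n^{-1/2}\,\widetilde P_{k-1}(X_j)\big]_{1\le j\le n,\,1\le k\le N+1}$ and $A_N=B_N'B_N$, let $\kappa_2(A_N)$ be the $2$-norm condition number of $A_N$,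 and, when $A_N$ is invertible, let $$\widehat f_{n,N}=\sum_{k=1}^{N+1}\widehat c_k\,\widetilde P_{k-1},\qquad (\widehat c_1,\dots,\widehat c_{N+1})'=A_N^{-1}B_N'\,\tfrac1{\sqrt n}(Y_1,\dots,Y_n)'.$$ A function $\overline f$ on $\mathbb R$ is $c$-bandlimited if $\overline f\in L^2(\mathbb R)$ and its Fourier transform $\int \overline f(x)e^{-ix\xi}\,dx$ (in the $L^2$ sense) is supported in $[-c,c]$. Corollary 2 (bandlimited regression function). For every $\alpha\ge-\tfrac12$ there is a constant $C_\alpha>0$, depending only on $\alpha$, such that the following holds. Let $c>0$, let $f:I\to\mathbb R$ be the restriction to $I$ of a $c$-bandlimited function $\overline f$, with $\|f\|_\omega\neq 0$, and let $0<\delta<1$. Then there are $n_0,N_0$ such that for all $n\ge n_0$ and $N\ge N_0$ with $N+1\le n$, the denominator below is positive and, with probability at least $(1-\delta)^2$, the matrix $A_N$ is invertible and $$\|f-\widehat f_{n,N}\|_\omega\le \eta_N^{(\alpha)}\|\overline f\|_{L^2(\mathbb R)}+\sqrt{2\kappa_2(A_N)}\;\frac{\big(\frac1n\log\frac2\delta\big)^{1/4}+\dfrac{\eta_N^{(\alpha)}\|\overline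 f\|_{L^2(\mathbb R)}}{\sqrt{\gamma_{\alpha,\alpha}}}+\pmb\eta_n}{\dfrac1{\sqrt{\gamma_{\alpha,\alpha}}}-2\big(\frac1n\log\frac2\delta\big)^{1/4}\dfrac{\|f\|_\infty}{\|f\|_\omega}},$$ where $$\eta_N^{(\alpha)}=c^{-1/2}\,C_\alpha\Big(\frac{ec}{2N+2}\Big)^{N+2}.$$ -/

import Mathlib

open MeasureTheory ProbabilityTheory Set
open scoped FourierTransform ENNReal

noncomputable section

namespace JacobiRegression

/-- The Jacobi weight `ω_{α,β}(x) = (1 - x)^α (1 + x)^β`, used on `I = [-1, 1]`. -/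
def weight (α β x : ℝ) : ℝ := (1 - x) ^ α * (1 + x) ^ β

/-- The measure `ω_{α,β}(x) dx` on `I = [-1, 1]`. -/
def weightMeasure (α β : ℝ) : Measure ℝ :=
  (volume.restrict (Icc (-1 : ℝ) 1)).withDensity fun x => ENNReal.ofReal (weight α β x)

/-- The norm `‖g‖_ω = (∫_{-1}^1 |g(x)|² ω_{α,β}(x) dx)^{1/2}`. -/
def weightedNorm (α β : ℝ) (g : ℝ → ℝ) : ℝ := (eLpNorm g 2 (weightMeasure α β)).toReal

/-- The (essential) supremum norm on `I = [-1, 1]`. -/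
def supNorm (g : ℝ → ℝ) : ℝ := (eLpNorm g ∞ (volume.restrict (Icc (-1 : ℝ) 1))).toReal

/-- The norm of `L²(ℝ)`. -/
def l2Norm (g : ℝ → ℂ) : ℝ := (eLpNorm g 2 (volume : Measure ℝ)).toReal

/-- `γ_{α,β} = B(α + 1, β + 1) 2^{α + β + 1}`, the total mass of the weight. -/
def gammaConst (α β : ℝ) : ℝ := ProbabilityTheory.beta (α + 1) (β + 1) * 2 ^ (α + β + 1)

/-- The beta distribution over `I = [-1, 1]`, of density `ω_{α,β} / γ_{α,β}`. -/
def betaLaw (α β : ℝ) : Measure ℝ :=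
  (volume.restrict (Icc (-1 : ℝ) 1)).withDensity fun x =>
    ENNReal.ofReal (weight α β x / gammaConst α β)

/-- The classical Jacobi polynomial
`P_k^{(α,β)}(x) = ∑ₛ C(k + α, k - s) C(k + β, s) ((x - 1) / 2)^s ((x + 1) / 2)^{k - s}`. -/
def jacobi (α β : ℝ) (k : ℕ) : Polynomial ℝ :=
  ∑ s ∈ Finset.range (k + 1),
    Polynomial.C (Ring.choose ((k : ℝ) + α) (k - s) * Ring.choose ((k : ℝ) + β) s) *
      (Polynomial.C (1 / 2) * (Polynomial.X - 1)) ^ s *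
      (Polynomial.C (1 / 2) * (Polynomial.X + 1)) ^ (k - s)

theorem choose_eq (a : ℝ) (j : ℕ) :
    Ring.choose a j = (descPochhammer ℝ j).eval a / j.factorial := by
  have h := Ring.descPochhammer_eq_factorial_smul_choose a j
  have h2 : (descPochhammer ℤ j).smeval a = (descPochhammer ℝ j).eval a := by
    rw [← descPochhammer_map (Int.castRingHom ℝ), Polynomial.eval_map, Polynomial.eval₂_eq_sum, Polynomial.smeval_eq_sum]
    simp [Polynomial.smul_pow, Polynomial.sum_def]
  rw [h2] at h
  rw [h, nsmul_eq_mul]; field_simp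

/-- The Rodrigues formula, which characterizes `jacobi α β k`. -/
theorem weight_mul_jacobi (α β : ℝ) (k : ℕ) {x : ℝ} (hx : x ∈ Ioo (-1 : ℝ) 1) :
    weight α β x * (jacobi α β k).eval x =
      (-1) ^ k / (2 ^ k * k.factorial) *
        iteratedDeriv k (fun y => weight α β y * (1 - y ^ 2) ^ k) x := by
  obtain ⟨h1, h2⟩ := hx
  have p1 : 0 < 1 - x := by linarith
  have p2 : 0 < 1 + x := by linarith
  have e : (fun y => weight α β y * (1 - y ^ 2) ^ k) =ᶠ[nhds x]
      fun y => (1 - y) ^ ((k:ℝ) + α) * (1 + y) ^ ((k:ℝ) + β) := by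
    filter_upwards [Ioo_mem_nhds h1 h2] with y hy
    have q1 : 0 < 1 - y := by linarith [hy.2]
    have q2 : 0 < 1 + y := by linarith [hy.1]
    rw [weight, Real.rpow_add q1, Real.rpow_add q2, Real.rpow_natCast, Real.rpow_natCast,
      show 1 - y ^ 2 = (1 - y) * (1 + y) by ring, mul_pow]
    ring
  rw [e.iteratedDeriv_eq k, iteratedDeriv_fun_mul]
  · have d1 : ∀ i, iteratedDeriv i (fun y : ℝ => (1 - y) ^ ((k:ℝ) + α)) x =
        (-1) ^ i * ((descPochhammer ℝ i).eval ((k:ℝ) + α) * (1 - x) ^ ((k:ℝ) + α - i)) := by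
      intro i
      have := congrFun (iteratedDeriv_comp_const_sub (n := i) (f := fun y : ℝ => y ^ ((k:ℝ) + α)) (s := 1)) x
      rw [this]
      simp only [iteratedDeriv_eq_iterate, Real.iter_deriv_rpow_const, smul_eq_mul]
    have d2 : ∀ i, iteratedDeriv i (fun y : ℝ => (1 + y) ^ ((k:ℝ) + β)) x =
        ((descPochhammer ℝ i).eval ((k:ℝ) + β) * (1 + x) ^ ((k:ℝ) + β - i)) := by
      intro i
      have := congrFun (iteratedDeriv_comp_const_add (n := i) (f := fun y : ℝ => y ^ ((k:ℝ) + β)) (s := 1)) x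
      rw [this]
      simp only [iteratedDeriv_eq_iterate, Real.iter_deriv_rpow_const]
    simp only [d1, d2]
    rw [jacobi, Polynomial.eval_finsetSum, Finset.mul_sum, Finset.mul_sum, ← Finset.sum_range_reflect]
    refine Finset.sum_congr rfl fun s hs => ?_
    have hs' : s ≤ k := by simpa [Nat.lt_succ_iff] using hs
    obtain ⟨m, rfl⟩ := Nat.exists_eq_add_of_le hs'
    have i1 : s + m + 1 - 1 - s = m := by omega
    have i2 : s + m - s = m := by omega
    have i3 : s + m - m = s := by omega
    rw [i1, i2, i3]
    have r1 : ((s + m : ℕ) : ℝ) + α - s = m + α := by push_cast; ring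
    have r2 : ((s + m : ℕ) : ℝ) + β - m = s + β := by push_cast; ring
    rw [r1, r2, Real.rpow_add p1, Real.rpow_add p2, Real.rpow_natCast, Real.rpow_natCast,
      choose_eq, choose_eq, weight, Nat.cast_choose ℝ hs', i2]
    simp only [Polynomial.eval_mul, Polynomial.eval_C, Polynomial.eval_pow, Polynomial.eval_sub,
      Polynomial.eval_add, Polynomial.eval_X, Polynomial.eval_one]
    rw [show (1/2 * (x-1)) = (-1) * (1-x) / 2 by ring, show (1/2*(x+1)) = (1+x)/2 by ring]
    have sg : ((-1:ℝ))^(s+m) * (-1)^s = (-1)^m := by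
      rw [pow_add, mul_right_comm, ← mul_pow]; norm_num
    have f1 : ((s + m).factorial : ℝ) ≠ 0 := by positivity
    rw [div_pow, div_pow, mul_pow, ← sg]
    field_simp
    ring_nf
    try simp [pow_mul]
  · exact ContDiffAt.rpow_const_of_ne (by fun_prop) p1.ne'
  · exact ContDiffAt.rpow_const_of_ne (by fun_prop) p2.ne'

/-- The squared norm `h_k` of `P_k^{(α,β)}`. For `k = 0` the factor
`(α + β + 1) Γ(α + β + 1)` is written `Γ(α + β + 2)`, which is its value, by continuity, also at
`α + β + 1 = 0`. -/
def jacobiSqNorm (α β : ℝ) (k : ℕ) : ℝ :=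
  2 ^ (α + β + 1) * Real.Gamma (k + α + 1) * Real.Gamma (k + β + 1) /
    (k.factorial * if k = 0 then Real.Gamma (α + β + 2)
      else (2 * k + α + β + 1) * Real.Gamma (k + α + β + 1))

/-- The normalized Jacobi polynomial of degree `k`, as a function. -/
def normJacobi (α β : ℝ) (k : ℕ) (x : ℝ) : ℝ :=
  (jacobi α β k).eval x / Real.sqrt (jacobiSqNorm α β k)

/-- The projection matrix `B_N = [n^{-1/2} P̃_k(x_j)]`, `1 ≤ j ≤ n`, `0 ≤ k ≤ N`. -/
def projMatrix (α β : ℝ) (N : ℕ) {n : ℕ} (x : Fin n → ℝ) : Matrix (Fin n) (Fin (N + 1)) ℝ :=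
  Matrix.of fun j k => 1 / Real.sqrt n * normJacobi α β k (x j)

/-- The Gram matrix `A_N = B_N' B_N`. -/
def gramMatrix (α β : ℝ) (N : ℕ) {n : ℕ} (x : Fin n → ℝ) :
    Matrix (Fin (N + 1)) (Fin (N + 1)) ℝ :=
  (projMatrix α β N x).transpose * projMatrix α β N x

/-- The 2-norm condition number `κ₂(A) = ‖A‖₂ ‖A⁻¹‖₂` of an invertible matrix. -/
def condNumber {m : ℕ} (A : Matrix (Fin m) (Fin m) ℝ) : ℝ :=
  ‖Matrix.toEuclideanCLM (n := Fin m) (𝕜 := ℝ) A‖ *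
    ‖Matrix.toEuclideanCLM (n := Fin m) (𝕜 := ℝ) A⁻¹‖

/-- The vector of coefficients `Ĉ = (B_N' B_N)⁻¹ B_N' Z_n`, with `Z_n = n^{-1/2} (y_1, …, y_n)'`. -/
def coeffs (α β : ℝ) (N : ℕ) {n : ℕ} (x y : Fin n → ℝ) : Fin (N + 1) → ℝ :=
  ((gramMatrix α β N x)⁻¹).mulVec
    ((projMatrix α β N x).transpose.mulVec fun j => 1 / Real.sqrt n * y j)

/-- The estimator `f̂_{n,N} = ∑ₖ Ĉ_k P̃_k` built from the data `(x_j, y_j)`. -/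
def estimator (α β : ℝ) (N : ℕ) {n : ℕ} (x y : Fin n → ℝ) (t : ℝ) : ℝ :=
  ∑ k : Fin (N + 1), coeffs α β N x y k * normJacobi α β k t

/-- `g` is `c`-bandlimited: `g ∈ L²(ℝ)`, and its (Plancherel) Fourier transform, in the angular
frequency `t = 2πξ`, vanishes almost everywhere outside `[-c, c]`. -/
def IsBandlimited (c : ℝ) (g : ℝ → ℂ) : Prop :=
  ∃ hg : MemLp g 2 (volume : Measure ℝ),
    ∀ᵐ ξ : ℝ, c < |2 * Real.pi * ξ| → (𝓕 (hg.toLp g) : Lp ℂ 2 (volume : Measure ℝ)) ξ = 0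

/-- The rate `η_N^{(α)} = c^{-1/2} C_α (e c / (2N + 2))^{N + 2}`, for the value `C` of `C_α`. -/
def etaRate (C c : ℝ) (N : ℕ) : ℝ :=
  c ^ (-(1 / 2) : ℝ) * C * (Real.exp 1 * c / (2 * N + 2)) ^ (N + 2)

/-- The deviation `((1 / n) log (2 / δ))^{1/4}`. -/
def deviation (n : ℕ) (δ : ℝ) : ℝ := (1 / (n : ℝ) * Real.log (2 / δ)) ^ (1 / 4 : ℝ)

/-- `γ_{α,β}^{-1/2} - 2 ((1 / n) log (2 / δ))^{1/4} ‖f‖_∞ / ‖f‖_ω`. -/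
def denom (α β : ℝ) (f : ℝ → ℝ) (n : ℕ) (δ : ℝ) : ℝ :=
  1 / Real.sqrt (gammaConst α β) - 2 * deviation n δ * (supNorm f / weightedNorm α β f)

end JacobiRegression

end

namespace JacobiRegression

/-! The asserted inequality holds almost surely, hence with probability at least $(1-\delta)^2$. No
concentration estimate is needed: randomness enters only through the nodes, which almost surely lie
in $I$, are distinct, and avoid the null set where $f$ differs from its smooth representative $h$.

Deterministic half. Distinct nodes with $n\ge N+1$ make $A_N$ invertible, since a polynomial of
degree at most $N$ with $n$ zeros vanishes. Least squares then reproduces every polynomial $q$ of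
degree at most $N$, so the coefficient error is $A_N^{-1}B_N'$ applied to the scaled residuals
$h-q+\varepsilon$. The operator $D=A_N^{-1}B_N'$ satisfies $DD'=A_N^{-1}$, hence
$\|D\|=\|A_N^{-1}\|^{1/2}$. Since $\widetilde P_0=\gamma^{-1/2}$, an entry of $A_N$ equals
$1/\gamma$, so $\|A_N\|\ge 1/\gamma$ and $\|D\|\le\sqrt{\kappa_2\gamma}$. Orthonormality of the
$\widetilde P_k$ turns this into a weighted norm bound (`weightedNorm_sub_estimator_le`).

Approximation half. Fourier inversion and Cauchy–Schwarz on the band bound all derivatives of $h$;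
interpolation at the Chebyshev nodes and Stirling's formula give a uniform error
$e=c^{-1/2}(ec/(2N+2))^{N+2}\|\overline f\|_{L^2(\mathbb R)}$
(`IsBandlimited.exists_polynomial_approx`).

With $C_\alpha=\sqrt\gamma$ the total is at most
$\sqrt\gamma\,e+\sqrt{\kappa_2}\sqrt\gamma\,(e+\eta_n)$, where $\eta_n$ is the largest noise. The
denominator is positive for large $n$ and at most $1/\sqrt\gamma$, so the claimed right-hand side is
larger. -/

/-! ### Integrability and total mass of the Jacobi weight. -/

theorem beta_kernel_integral {u v : ℝ} (hu : -1 < u) (hv : -1 < v) :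
    IntervalIntegrable (fun t : ℝ => t ^ u * (1 - t) ^ v) volume 0 1 ∧
      ∫ t in (0 : ℝ)..1, t ^ u * (1 - t) ^ v = ProbabilityTheory.beta (u + 1) (v + 1) := by
  have hF := Complex.betaIntegral_convergent (u := ((u + 1 : ℝ) : ℂ)) (v := ((v + 1 : ℝ) : ℂ))
    (by rw [Complex.ofReal_re]; linarith) (by rw [Complex.ofReal_re]; linarith)
  have e : EqOn (fun x : ℝ => (x : ℂ) ^ (((u + 1 : ℝ) : ℂ) - 1) *
      (1 - (x : ℂ)) ^ (((v + 1 : ℝ) : ℂ) - 1)) (fun x => ((x ^ u * (1 - x) ^ v : ℝ) : ℂ))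
      (uIcc 0 1) := by
    intro x hx
    rw [uIcc_of_le zero_le_one] at hx
    have h2 : 0 ≤ 1 - x := by linarith [hx.2]
    simp only [Complex.ofReal_add, Complex.ofReal_one, add_sub_cancel_right, Complex.ofReal_mul]
    rw [Complex.ofReal_cpow hx.1, Complex.ofReal_cpow h2, Complex.ofReal_sub, Complex.ofReal_one]
  have hF' : IntervalIntegrable (fun x : ℝ => ((x ^ u * (1 - x) ^ v : ℝ) : ℂ)) volume 0 1 :=
    (intervalIntegrable_congr (e.mono uIoc_subset_uIcc)).1 hF
  constructor
  · rw [intervalIntegrable_iff] at hF' ⊢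
    exact hF'.re
  · rw [ProbabilityTheory.beta_eq_betaIntegralReal _ _ (by linarith) (by linarith),
      Complex.betaIntegral, intervalIntegral.integral_congr e, intervalIntegral.integral_ofReal,
      Complex.ofReal_re]

theorem weight_eq_beta_kernel (α β : ℝ) {y : ℝ} (hy : y ∈ Icc (-1 : ℝ) 1) :
    weight α β y =
      2 ^ (α + β) * ((y / 2 + 1 / 2) ^ β * (1 - (y / 2 + 1 / 2)) ^ α) := by
  have h1 : 1 - y = 2 * (1 - (y / 2 + 1 / 2)) := by ring
  have h2 : 1 + y = 2 * (y / 2 + 1 / 2) := by ring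
  rw [weight, h1, h2, Real.mul_rpow two_pos.le (by linarith [hy.2]),
    Real.mul_rpow two_pos.le (by linarith [hy.1]), Real.rpow_add two_pos]
  ring

theorem intervalIntegrable_weight {α β : ℝ} (hα : -1 < α) (hβ : -1 < β) :
    IntervalIntegrable (weight α β) volume (-1) 1 := by
  have h := ((beta_kernel_integral hβ hα).1.comp_add_right (1 / 2)).comp_mul_left (c := 1 / 2)
  have h2 := h.const_mul (2 ^ (α + β))
  norm_num at h2
  refine h2.congr fun y hy => ?_
  rw [uIoc_of_le (by norm_num)] at hy
  rw [weight_eq_beta_kernel α β ⟨hy.1.le, hy.2⟩]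
  ring_nf

theorem integral_weight {α β : ℝ} (hα : -1 < α) (hβ : -1 < β) :
    ∫ y in (-1 : ℝ)..1, weight α β y = gammaConst α β := by
  have e : EqOn (weight α β) (fun y => 2 ^ (α + β) * ((fun t : ℝ => t ^ β * (1 - t) ^ α)
      (y / 2 + 1 / 2))) (uIcc (-1) 1) := fun y hy => by
    rw [uIcc_of_le (by norm_num)] at hy
    exact weight_eq_beta_kernel α β hy
  rw [intervalIntegral.integral_congr e, intervalIntegral.integral_const_mul,
    intervalIntegral.integral_comp_div_add (fun t : ℝ => t ^ β * (1 - t) ^ α) two_ne_zero]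
  norm_num
  rw [(beta_kernel_integral hβ hα).2, gammaConst, Real.rpow_add_one two_ne_zero,
    ProbabilityTheory.beta, ProbabilityTheory.beta, add_comm (β + 1)]
  ring

theorem gammaConst_pos {α β : ℝ} (hα : -1 < α) (hβ : -1 < β) : 0 < gammaConst α β :=
  mul_pos (ProbabilityTheory.beta_pos (by linarith) (by linarith)) (by positivity)

theorem intervalIntegrable_weight_mul {α β : ℝ} (hα : -1 < α) (hβ : -1 < β) {g : ℝ → ℝ}
    (hg : ContinuousOn g (Icc (-1) 1)) :
    IntervalIntegrable (fun x => weight α β x * g x) volume (-1) 1 :=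
  (intervalIntegrable_weight hα hβ).mul_continuousOn (by rwa [uIcc_of_le (by norm_num)])

/-! ### Orthogonality, norms and span of the Jacobi polynomials. -/

/-- In Rodrigues' formula both sides come from the same function, because
$\omega_{\alpha+1,\beta+1}(1-y^2)^k=\omega_{\alpha,\beta}(1-y^2)^{k+1}$; one more derivative passes
from $k$ to $k+1$, and $-2(k+1)$ is the ratio of the two prefactors. -/
theorem hasDerivAt_weight_mul_jacobi (α β : ℝ) (k : ℕ) {x : ℝ} (hx : x ∈ Ioo (-1 : ℝ) 1) :
    HasDerivAt (fun y => weight (α + 1) (β + 1) y * (jacobi (α + 1) (β + 1) k).eval y)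
      (-(2 * (k + 1)) * (weight α β x * (jacobi α β (k + 1)).eval x)) x := by
  have hnhds : Ioo (-1 : ℝ) 1 ∈ nhds x := Ioo_mem_nhds hx.1 hx.2
  set F : ℝ → ℝ := fun y => weight α β y * (1 - y ^ 2) ^ (k + 1)
  set G : ℝ → ℝ := fun y => weight (α + 1) (β + 1) y * (1 - y ^ 2) ^ k
  set W : ℝ → ℝ := fun y => weight (α + 1) (β + 1) y * (jacobi (α + 1) (β + 1) k).eval y
  have hFG : EqOn F G (Ioo (-1) 1) := by
    intro y hy
    have p1 : 0 < 1 - y := by linarith [hy.2]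
    have p2 : 0 < 1 + y := by linarith [hy.1]
    simp only [F, G, weight]
    rw [Real.rpow_add_one p1.ne', Real.rpow_add_one p2.ne', pow_succ]
    ring
  have hW : W =ᶠ[nhds x] fun y => (-1) ^ k / (2 ^ k * k.factorial) * iteratedDeriv k F y := by
    filter_upwards [hnhds] with y hy
    have : F =ᶠ[nhds y] G := Filter.eventuallyEq_of_mem (Ioo_mem_nhds hy.1 hy.2) hFG
    rw [this.iteratedDeriv_eq k]
    exact weight_mul_jacobi (α + 1) (β + 1) k hy
  -- Needed separately: `deriv` has a default value, so the formula for it does not by itself give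
  -- differentiability.
  have hd : DifferentiableAt ℝ W x := by
    have p1 : 1 - x ≠ 0 := by linarith [hx.2]
    have p2 : 1 + x ≠ 0 := by linarith [hx.1]
    refine DifferentiableAt.mul (DifferentiableAt.mul ?_ ?_) (Polynomial.differentiableAt _)
    · exact DifferentiableAt.rpow_const (by fun_prop) (Or.inl p1)
    · exact DifferentiableAt.rpow_const (by fun_prop) (Or.inl p2)
  have key : deriv W x = -(2 * (k + 1)) * (weight α β x * (jacobi α β (k + 1)).eval x) := by
    rw [hW.deriv_eq, deriv_const_mul_field, weight_mul_jacobi α β (k + 1) hx, iteratedDeriv_succ]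
    have : ((k.factorial : ℕ) : ℝ) ≠ 0 := by positivity
    rw [Nat.factorial_succ]
    push_cast
    field_simp
    ring
  exact key ▸ hd.hasDerivAt

theorem continuous_weight {α β : ℝ} (hα : 0 ≤ α) (hβ : 0 ≤ β) : Continuous (weight α β) :=
  ((continuous_const.sub continuous_id).rpow_const fun _ => Or.inr hα).mul
    ((continuous_const.add continuous_id).rpow_const fun _ => Or.inr hβ)

/-- Integration by parts; the boundary terms vanish since $\alpha+1,\beta+1>0$. -/
theorem integral_weight_mul_jacobi_succ {α β : ℝ} (hα : -1 < α) (hβ : -1 < β) (k : ℕ)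
    (q : Polynomial ℝ) :
    ∫ x in (-1 : ℝ)..1, weight α β x * ((jacobi α β (k + 1)).eval x * q.eval x) =
      1 / (2 * (k + 1)) * ∫ x in (-1 : ℝ)..1, weight (α + 1) (β + 1) x *
        ((jacobi (α + 1) (β + 1) k).eval x * q.derivative.eval x) := by
  have hc : Continuous (weight (α + 1) (β + 1)) :=
    continuous_weight (by linarith) (by linarith)
  have i1 : IntervalIntegrable (fun x => -(2 * ((k : ℝ) + 1)) *
      (weight α β x * ((jacobi α β (k + 1)).eval x * q.eval x))) volume (-1) 1 :=
    (intervalIntegrable_weight_mul hα hβ (by fun_prop)).const_mul _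
  have i2 : IntervalIntegrable (fun x => weight (α + 1) (β + 1) x *
      ((jacobi (α + 1) (β + 1) k).eval x * q.derivative.eval x)) volume (-1) 1 :=
    (by fun_prop : Continuous _).intervalIntegrable _ _
  have h := intervalIntegral.integral_eq_sub_of_hasDerivAt_of_le (a := (-1 : ℝ)) (b := 1)
    (f := fun x => weight (α + 1) (β + 1) x * (jacobi (α + 1) (β + 1) k).eval x * q.eval x)
    (f' := fun x => -(2 * ((k : ℝ) + 1)) *
      (weight α β x * ((jacobi α β (k + 1)).eval x * q.eval x)) + weight (α + 1) (β + 1) x *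
      ((jacobi (α + 1) (β + 1) k).eval x * q.derivative.eval x))
    (by norm_num) (by fun_prop) (fun x hx => by
      convert! (hasDerivAt_weight_mul_jacobi α β k hx).mul (q.hasDerivAt x) using 1
      ring) (i1.add i2)
  have z1 : weight (α + 1) (β + 1) 1 = 0 := by
    simp [weight, Real.zero_rpow (by linarith : α + 1 ≠ 0)]
  have z2 : weight (α + 1) (β + 1) (-1) = 0 := by
    simp [weight, Real.zero_rpow (by linarith : β + 1 ≠ 0)]
  rw [intervalIntegral.integral_add i1 i2, intervalIntegral.integral_const_mul, z1, z2] at h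
  have : (k : ℝ) + 1 ≠ 0 := by positivity
  rw [one_div, eq_inv_mul_iff_mul_eq₀ (by positivity)]
  linarith

/-- Taking $q$ to be a Jacobi polynomial, this one identity yields the orthogonality, the norms, and
the nonvanishing of the leading coefficients. -/
theorem integral_weight_mul_jacobi {α β : ℝ} (hα : -1 < α) (hβ : -1 < β) (k : ℕ)
    (q : Polynomial ℝ) :
    ∫ x in (-1 : ℝ)..1, weight α β x * ((jacobi α β k).eval x * q.eval x) =
      1 / (2 ^ k * k.factorial) * ∫ x in (-1 : ℝ)..1, weight (α + k) (β + k) x *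
        (Polynomial.derivative^[k] q).eval x := by
  induction k generalizing α β q with
  | zero => simp [jacobi]
  | succ k ih =>
    rw [integral_weight_mul_jacobi_succ hα hβ, ih (by linarith) (by linarith),
      Function.iterate_succ_apply, Nat.factorial_succ]
    have e1 : α + 1 + (k : ℝ) = α + ((k + 1 : ℕ) : ℝ) := by push_cast; ring
    have e2 : β + 1 + (k : ℝ) = β + ((k + 1 : ℕ) : ℝ) := by push_cast; ring
    rw [e1, e2, ← mul_assoc]
    congr 1
    push_cast
    field_simp
    ring

theorem natDegree_jacobi_le (α β : ℝ) (k : ℕ) : (jacobi α β k).natDegree ≤ k := by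
  refine Polynomial.natDegree_sum_le_of_forall_le _ _ fun s hs => ?_
  have hs' : s ≤ k := by simpa [Nat.lt_succ_iff] using hs
  have : k = 0 + s * 1 + (k - s) * 1 := by omega
  conv_rhs => rw [this]
  refine Polynomial.natDegree_mul_le_of_le (Polynomial.natDegree_mul_le_of_le ?_ ?_) ?_
  · exact (Polynomial.natDegree_C _).le
  · exact Polynomial.natDegree_pow_le_of_le _ (by compute_degree)
  · exact Polynomial.natDegree_pow_le_of_le _ (by compute_degree)

/-- Each summand contributes the product of its binomials over $2^k$; the sum is Vandermonde's
identity. -/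
theorem coeff_jacobi (α β : ℝ) (k : ℕ) :
    (jacobi α β k).coeff k = Ring.choose (2 * (k : ℝ) + α + β) k / 2 ^ k := by
  have h : Ring.choose (2 * (k : ℝ) + α + β) k = ∑ s ∈ Finset.range (k + 1),
      Ring.choose ((k : ℝ) + α) (k - s) * Ring.choose ((k : ℝ) + β) s := by
    rw [show 2 * (k : ℝ) + α + β = ((k : ℝ) + β) + ((k : ℝ) + α) by ring,
      Ring.add_choose_eq k (Commute.all _ _), Finset.Nat.sum_antidiagonal_eq_sum_range_succ
        (fun i j => Ring.choose ((k : ℝ) + β) i * Ring.choose ((k : ℝ) + α) j)]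
    exact Finset.sum_congr rfl fun s _ => mul_comm _ _
  rw [h, jacobi, Polynomial.finsetSum_coeff, Finset.sum_div]
  refine Finset.sum_congr rfl fun s hs => ?_
  have hs' : s ≤ k := by simpa [Nat.lt_succ_iff] using hs
  obtain ⟨m, rfl⟩ := Nat.exists_eq_add_of_le hs'
  have d1 : ((Polynomial.C (1 / 2 : ℝ) * (Polynomial.X - 1)) ^ s).natDegree ≤ s := 
    (Polynomial.natDegree_pow_le_of_le (p := Polynomial.C (1 / 2 : ℝ) *
      (Polynomial.X - 1)) s (m := 1) (by compute_degree)).trans (mul_one _).le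
  have d2 : ((Polynomial.C (1 / 2 : ℝ) * (Polynomial.X + 1)) ^ m).natDegree ≤ m := 
    (Polynomial.natDegree_pow_le_of_le (p := Polynomial.C (1 / 2 : ℝ) *
      (Polynomial.X + 1)) m (m := 1) (by compute_degree)).trans (mul_one _).le
  have c1 : ((Polynomial.C (1 / 2 : ℝ) * (Polynomial.X - 1)) ^ s).coeff s = (1 / 2) ^ s := by
    have := Polynomial.coeff_pow_of_natDegree_le (p := Polynomial.C (1 / 2 : ℝ) *
      (Polynomial.X - 1)) (m := s) (n := 1) (by compute_degree)
    rw [mul_one] at this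
    rw [this]
    simp [Polynomial.coeff_one]
  have c2 : ((Polynomial.C (1 / 2 : ℝ) * (Polynomial.X + 1)) ^ m).coeff m = (1 / 2) ^ m := by
    have := Polynomial.coeff_pow_of_natDegree_le (p := Polynomial.C (1 / 2 : ℝ) *
      (Polynomial.X + 1)) (m := m) (n := 1) (by compute_degree)
    rw [mul_one] at this
    rw [this]
    simp [Polynomial.coeff_one]
  rw [show s + m - s = m by omega, mul_assoc, Polynomial.coeff_C_mul,
    Polynomial.coeff_mul_add_eq_of_natDegree_le d1 d2, c1, c2, ← pow_add, one_div, inv_pow,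
    div_eq_mul_inv]

theorem eval_iterate_derivative_of_natDegree_le {k : ℕ} {q : Polynomial ℝ}
    (hq : q.natDegree ≤ k) (x : ℝ) :
    (Polynomial.derivative^[k] q).eval x = k.factorial * q.coeff k := by
  have h : (Polynomial.derivative^[k] q).natDegree ≤ 0 :=
    (Polynomial.natDegree_iterate_derivative q k).trans (by omega)
  rw [Polynomial.eq_C_of_natDegree_le_zero h, Polynomial.eval_C,
    Polynomial.coeff_iterate_derivative]
  simp [Nat.descFactorial_self]

theorem Gamma_add_nat {s : ℝ} (hs : 0 < s) (m : ℕ) :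
    Real.Gamma (s + m) = (∏ j ∈ Finset.range m, (s + m - 1 - j)) * Real.Gamma s := by
  induction m with
  | zero => simp
  | succ m ih =>
    have e : s + ((m + 1 : ℕ) : ℝ) = (s + m) + 1 := by push_cast; ring
    rw [e, Real.Gamma_add_one (by positivity), ih, Finset.prod_range_succ', ← mul_assoc]
    congr 1
    rw [mul_comm]
    congr 1
    · refine Finset.prod_congr rfl fun j _ => ?_
      push_cast; ring
    · push_cast; ring

/-- The $k$-th derivative of $P_k$ is the constant $k!$ times its top coefficient, so what remains
is the mass $\gamma_{\alpha+k,\beta+k}$ and Gamma function algebra. -/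
theorem integral_weight_mul_jacobi_sq {α β : ℝ} (hα : -1 < α) (hβ : -1 < β) (k : ℕ) :
    ∫ x in (-1 : ℝ)..1, weight α β x * ((jacobi α β k).eval x * (jacobi α β k).eval x) =
      jacobiSqNorm α β k := by
  rw [integral_weight_mul_jacobi hα hβ]
  simp only [eval_iterate_derivative_of_natDegree_le (natDegree_jacobi_le α β k)]
  have hk0 : (0 : ℝ) ≤ k := k.cast_nonneg
  rw [intervalIntegral.integral_mul_const, integral_weight (by linarith) (by linarith),
    coeff_jacobi, choose_eq, descPochhammer_eval_eq_prod_range, gammaConst,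
    ProbabilityTheory.beta, jacobiSqNorm]
  have e2 : (2 : ℝ) ^ (α + k + (β + k) + 1) = 2 ^ (α + β + 1) * (2 ^ k * 2 ^ k) := by
    rw [show α + k + (β + k) + 1 = α + β + 1 + k + k by ring, Real.rpow_add two_pos,
      Real.rpow_add two_pos, Real.rpow_natCast, mul_assoc]
  rw [e2, show α + k + 1 = k + α + 1 by ring, show β + k + 1 = k + β + 1 by ring,
    show (k : ℝ) + α + 1 + (k + β + 1) = 2 * k + α + β + 2 by ring]
  have hf : (k.factorial : ℝ) ≠ 0 := by positivity
  -- For $k\ge1$ the argument $k+\alpha+\beta+1$ is positive; at $k=0$ it may fail to be, whence the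
  -- separate branch in `jacobiSqNorm`.
  rcases Nat.eq_zero_or_pos k with rfl | hk
  · simp
    ring
  · have hk1 : (1 : ℝ) ≤ k := by exact_mod_cast hk
    rw [if_neg hk.ne']
    have g1 := Gamma_add_nat (s := k + α + β + 1) (by linarith) k
    have e3 : ∀ j : ℕ, (k : ℝ) + α + β + 1 + k - 1 - j = 2 * k + α + β - j := fun j => by ring
    simp only [e3] at g1
    have p0 : 0 < 2 * (k : ℝ) + α + β + 1 := by linarith
    have g2 : Real.Gamma (2 * k + α + β + 2) =
        (2 * k + α + β + 1) * Real.Gamma (k + α + β + 1 + k) := by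
      rw [show 2 * (k : ℝ) + α + β + 2 = (2 * k + α + β + 1) + 1 by ring,
        Real.Gamma_add_one p0.ne']
      congr 2; ring
    have p1 : Real.Gamma (k + α + β + 1) ≠ 0 := (Real.Gamma_pos_of_pos (by linarith)).ne'
    have p2 : Real.Gamma (k + α + β + 1 + k) ≠ 0 := (Real.Gamma_pos_of_pos (by linarith)).ne'
    have p3 : ∏ j ∈ Finset.range k, (2 * (k : ℝ) + α + β - j) ≠ 0 := by
      intro h; rw [h, zero_mul] at g1; exact p2 g1
    rw [g2, g1]
    generalize ∏ j ∈ Finset.range k, (2 * (k : ℝ) + α + β - j) = Q at p3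
    field_simp

theorem jacobiSqNorm_pos {α β : ℝ} (hα : -1 < α) (hβ : -1 < β) (k : ℕ) :
    0 < jacobiSqNorm α β k := by
  have hk0 : (0 : ℝ) ≤ k := k.cast_nonneg
  rw [jacobiSqNorm]
  refine div_pos (mul_pos (mul_pos (by positivity) (Real.Gamma_pos_of_pos (by linarith)))
    (Real.Gamma_pos_of_pos (by linarith))) (mul_pos (by positivity) ?_)
  split_ifs with h
  · exact Real.Gamma_pos_of_pos (by linarith)
  · have hk1 : (1 : ℝ) ≤ k := by exact_mod_cast Nat.pos_of_ne_zero h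
    exact mul_pos (by linarith) (Real.Gamma_pos_of_pos (by linarith))

theorem coeff_jacobi_ne_zero {α β : ℝ} (hα : -1 < α) (hβ : -1 < β) (k : ℕ) :
    (jacobi α β k).coeff k ≠ 0 := by
  intro h
  have h1 := integral_weight_mul_jacobi_sq hα hβ k
  rw [integral_weight_mul_jacobi hα hβ] at h1
  simp only [eval_iterate_derivative_of_natDegree_le (natDegree_jacobi_le α β k), h] at h1
  simp only [mul_zero, intervalIntegral.integral_zero] at h1
  exact (jacobiSqNorm_pos hα hβ k).ne h1

theorem integral_weight_mul_jacobi_of_lt {α β : ℝ} (hα : -1 < α) (hβ : -1 < β) {j k : ℕ}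
    (h : j < k) :
    ∫ x in (-1 : ℝ)..1, weight α β x * ((jacobi α β k).eval x * (jacobi α β j).eval x) = 0 := by
  rw [integral_weight_mul_jacobi hα hβ,
    Polynomial.iterate_derivative_eq_zero ((natDegree_jacobi_le α β j).trans_lt h)]
  simp

/-- Orthonormality of the normalized Jacobi polynomials. -/
theorem integral_weight_mul_normJacobi {α β : ℝ} (hα : -1 < α) (hβ : -1 < β) (j k : ℕ) :
    ∫ x in (-1 : ℝ)..1, weight α β x * (normJacobi α β j x * normJacobi α β k x) =
      if j = k then 1 else 0 := by
  have e : ∀ x, weight α β x * (normJacobi α β j x * normJacobi α β k x) =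
      1 / (Real.sqrt (jacobiSqNorm α β j) * Real.sqrt (jacobiSqNorm α β k)) *
        (weight α β x * ((jacobi α β j).eval x * (jacobi α β k).eval x)) := fun x => by
    simp only [normJacobi]
    ring
  simp only [e, intervalIntegral.integral_const_mul]
  split_ifs with h
  · subst h
    have := jacobiSqNorm_pos hα hβ j
    rw [integral_weight_mul_jacobi_sq hα hβ, Real.mul_self_sqrt this.le]
    field_simp
  · rcases Nat.lt_or_gt_of_ne h with h | h
    · simp only [mul_comm (Polynomial.eval _ (jacobi α β j))]
      rw [integral_weight_mul_jacobi_of_lt hα hβ h, mul_zero]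
    · rw [integral_weight_mul_jacobi_of_lt hα hβ h, mul_zero]

theorem continuous_normJacobi (α β : ℝ) (k : ℕ) : Continuous (normJacobi α β k) :=
  (Polynomial.continuous _).div_const _

/-- The normalized Jacobi polynomials of degree at most `N` span the polynomials of degree at
most `N`. -/
theorem exists_eval_eq_sum_normJacobi {α β : ℝ} (hα : -1 < α) (hβ : -1 < β) (N : ℕ)
    (q : Polynomial ℝ) (hq : q.natDegree ≤ N) :
    ∃ d : Fin (N + 1) → ℝ, ∀ x, q.eval x = ∑ k : Fin (N + 1), d k * normJacobi α β k x := by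
  induction N generalizing q with
  | zero =>
    have h0 := Real.sqrt_pos.2 (jacobiSqNorm_pos hα hβ 0)
    refine ⟨fun _ => q.coeff 0 * Real.sqrt (jacobiSqNorm α β 0), fun x => ?_⟩
    rw [Polynomial.eq_C_of_natDegree_le_zero hq]
    simp [normJacobi, jacobi]
    field_simp
  | succ N ih =>
    have h0 := Real.sqrt_pos.2 (jacobiSqNorm_pos hα hβ (N + 1))
    have hc := coeff_jacobi_ne_zero hα hβ (N + 1)
    -- Chosen to cancel the coefficient of degree $N+1$ in $q$.
    set t := q.coeff (N + 1) / (jacobi α β (N + 1)).coeff (N + 1)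
    have hdeg : (q - Polynomial.C t * jacobi α β (N + 1)).natDegree ≤ N := by
      refine Polynomial.natDegree_le_pred (n := N + 1) ?_ ?_
      · exact (Polynomial.natDegree_sub_le_of_le hq ((Polynomial.natDegree_C_mul_le _ _).trans
          (natDegree_jacobi_le α β _))).trans (by simp)
      · simp [t, hc]
    obtain ⟨d, hd⟩ := ih _ hdeg
    refine ⟨Fin.snoc d (t * Real.sqrt (jacobiSqNorm α β (N + 1))), fun x => ?_⟩
    rw [Fin.sum_univ_castSucc]
    simp only [Fin.snoc_castSucc, Fin.snoc_last, Fin.val_castSucc, Fin.val_last]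
    rw [← hd x, normJacobi]
    simp
    field_simp
    ring

/-! ### Chebyshev interpolation and its rate. -/

/-- Rolle's theorem, iterated: each differentiation costs one zero. -/
theorem exists_iteratedDeriv_eq_zero {n : ℕ} {g : ℝ → ℝ} (hg : ContDiff ℝ n g) {a b : ℝ}
    {x : Fin (n + 1) → ℝ} (hx : StrictMono x) (hab : ∀ i, x i ∈ Icc a b)
    (h0 : ∀ i, g (x i) = 0) : ∃ ξ ∈ Icc a b, iteratedDeriv n g ξ = 0 := by
  induction n generalizing g with
  | zero => exact ⟨x 0, hab 0, by simpa using h0 0⟩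
  | succ n ih =>
    have hr : ∀ i : Fin (n + 1), ∃ y ∈ Ioo (x i.castSucc) (x i.succ), deriv g y = 0 := fun i =>
      exists_deriv_eq_zero (hx (Fin.castSucc_lt_succ)) hg.continuous.continuousOn
        (by rw [h0, h0])
    choose y hy hy0 using hr
    have hy_mono : StrictMono y := by
      refine Fin.strictMono_iff_lt_succ.2 fun i => ?_
      have h1 := (hy i.castSucc).2
      have h2 := (hy i.succ).1
      rw [Fin.succ_castSucc] at h1
      exact h1.trans h2
    obtain ⟨ξ, hξ, h⟩ := ih (g := deriv g) (hg.deriv' ) hy_mono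
      (fun i => ⟨(hab _).1.trans (hy i).1.le, (hy i).2.le.trans (hab _).2⟩) hy0
    exact ⟨ξ, hξ, by rw [iteratedDeriv_succ']; exact h⟩

theorem iteratedDeriv_polynomial_eval (p : Polynomial ℝ) (n : ℕ) :
    iteratedDeriv n (fun x => p.eval x) = fun x => (Polynomial.derivative^[n] p).eval x := by
  induction n generalizing p with
  | zero => simp
  | succ n ih =>
    rw [iteratedDeriv_succ', Function.iterate_succ_apply, ← ih]
    congr 1
    ext x
    exact p.deriv

/-- The remainder formula of Lagrange interpolation, as a bound. -/
theorem abs_sub_interpolate_le {s : Finset ℝ} {f : ℝ → ℝ} (hf : ContDiff ℝ s.card f) {a b M : ℝ}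
    (hs : ∀ t ∈ s, t ∈ Icc a b) (hM : ∀ t ∈ Icc a b, |iteratedDeriv s.card f t| ≤ M) {x : ℝ}
    (hx : x ∈ Icc a b) :
    |f x - (Lagrange.interpolate s id f).eval x| ≤
      M / s.card.factorial * |(Lagrange.nodal s id).eval x| := by
  by_cases hxs : x ∈ s
  · have : (Lagrange.interpolate s id f).eval (id x) = f x :=
      Lagrange.eval_interpolate_at_node f (injOn_id _) hxs
    have hM0 : 0 ≤ M := (abs_nonneg _).trans (hM x hx)
    rw [id] at this
    rw [this, sub_self, abs_zero]
    positivity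
  set p := Lagrange.interpolate s id f with hp
  set w := Lagrange.nodal s (id : ℝ → ℝ) with hw
  have hw0 : w.eval x ≠ 0 := by
    rw [hw, Lagrange.eval_nodal]
    exact Finset.prod_ne_zero_iff.2 fun i hi h => hxs ((sub_eq_zero.1 h).symm ▸ hi)
  -- Makes $r=p+Kw$ agree with $f$ at $x$ as well as at the nodes, so $f-r$ has one more zero than
  -- there are nodes.
  set K := (f x - p.eval x) / w.eval x with hK
  set r : Polynomial ℝ := p + Polynomial.C K * w with hr
  have hz : ∀ t ∈ insert x s, f t - r.eval t = 0 := by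
    intro t ht
    rcases Finset.mem_insert.1 ht with rfl | ht
    · simp only [hr, hK, Polynomial.eval_add, Polynomial.eval_mul, Polynomial.eval_C]
      field_simp
      ring
    · have h1 : p.eval (id t) = f t := Lagrange.eval_interpolate_at_node f (injOn_id _) ht
      have h2 : w.eval (id t) = 0 := Lagrange.eval_nodal_at_node ht
      rw [id] at h1 h2
      simp [hr, h1, h2]
  have hcard : (insert x s).card = s.card + 1 := Finset.card_insert_of_notMem hxs
  have hrsm : ContDiff ℝ s.card (fun t => r.eval t) := by
    simpa using r.contDiff_aeval s.card (𝕜 := ℝ) (R := ℝ)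
  obtain ⟨ξ, hξ, h⟩ := exists_iteratedDeriv_eq_zero (g := fun t => f t - r.eval t)
    (a := a) (b := b) (hf.sub hrsm) ((insert x s).orderEmbOfFin hcard).strictMono
    (fun i => by
      rcases Finset.mem_insert.1 ((insert x s).orderEmbOfFin_mem hcard i) with h | h
      · rw [h]; exact hx
      · exact hs _ h)
    (fun i => hz _ ((insert x s).orderEmbOfFin_mem hcard i))
  rw [iteratedDeriv_fun_sub hf.contDiffAt hrsm.contDiffAt, iteratedDeriv_polynomial_eval] at h
  have hpd : p.degree < s.card := Lagrange.degree_interpolate_lt f (injOn_id _)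
  have hwd : w.natDegree = s.card := Lagrange.natDegree_nodal
  have hrd : r.natDegree ≤ s.card := by
    refine Polynomial.natDegree_add_le_of_degree_le (Polynomial.natDegree_le_of_degree_le hpd.le) ?_
    exact (Polynomial.natDegree_C_mul_le _ _).trans hwd.le
  have hrc : r.coeff s.card = K := by
    have hm : w.coeff s.card = 1 := by
      rw [← hwd]; exact Lagrange.nodal_monic
    rw [hr, Polynomial.coeff_add, Polynomial.coeff_C_mul, hm,
      Polynomial.coeff_eq_zero_of_degree_lt hpd]
    ring
  have hd : (Polynomial.derivative^[s.card] r).eval ξ = s.card.factorial * K := by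
    rw [eval_iterate_derivative_of_natDegree_le hrd, hrc]
  simp only [hd, sub_eq_zero] at h
  have hb := hM ξ hξ
  rw [h, abs_mul, Nat.abs_cast] at hb
  have e : f x - p.eval x = K * w.eval x := by rw [hK]; field_simp
  rw [e, abs_mul]
  refine mul_le_mul_of_nonneg_right ?_ (abs_nonneg _)
  rw [le_div_iff₀ (by positivity)]
  linarith

/-- Interpolation at the Chebyshev nodes. -/
theorem exists_polynomial_abs_sub_le {f : ℝ → ℝ} (N : ℕ) (hf : ContDiff ℝ (N + 1 : ℕ) f) {M : ℝ}
    (hM : ∀ t ∈ Icc (-1 : ℝ) 1, |iteratedDeriv (N + 1) f t| ≤ M) :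
    ∃ q : Polynomial ℝ, q.natDegree ≤ N ∧
      ∀ x ∈ Icc (-1 : ℝ) 1, |f x - q.eval x| ≤ M / ((N + 1).factorial * 2 ^ N) := by
  set s : Finset ℝ := (Finset.range (N + 1)).image
    (fun k : ℕ => Real.cos ((2 * k + 1) * Real.pi / (2 * ((N + 1 : ℕ) : ℝ)))) with hs
  have hroots : (Polynomial.Chebyshev.T ℝ ((N + 1 : ℕ) : ℤ)).roots = s.val :=
    Polynomial.Chebyshev.roots_T_real (N + 1)
  have hTd : (Polynomial.Chebyshev.T ℝ ((N + 1 : ℕ) : ℤ)).natDegree = N + 1 := by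
    rw [Polynomial.Chebyshev.natDegree_T]; rfl
  have hTl : (Polynomial.Chebyshev.T ℝ ((N + 1 : ℕ) : ℤ)).leadingCoeff = 2 ^ N := by
    rw [Polynomial.Chebyshev.leadingCoeff_T]; rfl
  have hcard : s.card = N + 1 := by
    have h := Polynomial.Chebyshev.roots_T_real_nodup (N + 1)
    rw [hs, Finset.card_image_of_injOn, Finset.card_range]
    exact (Finset.nodup_map_iff_injOn).1 h
  -- Together with $|T_{N+1}|\le1$ on $I$, this bounds the nodal polynomial by $2^{-N}$.
  have hT : Polynomial.Chebyshev.T ℝ ((N + 1 : ℕ) : ℤ) =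
      Polynomial.C (2 ^ N) * Lagrange.nodal s id := by
    have h := Polynomial.C_leadingCoeff_mul_prod_multiset_X_sub_C
      (p := Polynomial.Chebyshev.T ℝ ((N + 1 : ℕ) : ℤ))
      (by rw [hroots, hTd]; exact hcard)
    rw [← h, hTl, hroots, Lagrange.nodal_eq]
    rfl
  refine ⟨Lagrange.interpolate s id f, ?_, fun x hx => ?_⟩
  · have hpd : (Lagrange.interpolate s id f).degree < ((N + 1 : ℕ) : WithBot ℕ) :=
      hcard ▸ Lagrange.degree_interpolate_lt f (injOn_id _)
    exact Polynomial.natDegree_le_iff_coeff_eq_zero.2 fun m hm =>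
      Polynomial.coeff_eq_zero_of_degree_lt (hpd.trans_le (by exact_mod_cast hm))
  · have hM0 : 0 ≤ M := (abs_nonneg _).trans (hM x hx)
    have h := abs_sub_interpolate_le (s := s) (a := -1) (b := 1) (M := M) (hcard ▸ hf)
      (fun t ht => by
        rw [hs, Finset.mem_image] at ht
        obtain ⟨k, -, rfl⟩ := ht
        exact ⟨Real.neg_one_le_cos _, Real.cos_le_one _⟩) (hcard ▸ hM) hx
    have h1 : |(Polynomial.Chebyshev.T ℝ ((N + 1 : ℕ) : ℤ)).eval x| ≤ 1 :=
      Polynomial.Chebyshev.abs_eval_T_real_le_one _ (abs_le.2 hx)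
    rw [hT, Polynomial.eval_mul, Polynomial.eval_C, abs_mul,
      abs_of_pos (by positivity : (0 : ℝ) < 2 ^ N)] at h1
    rw [hcard] at h
    refine h.trans ?_
    rw [← div_div, div_eq_mul_inv (M / _)]
    refine mul_le_mul_of_nonneg_left ?_ (by positivity)
    rw [← one_div, le_div_iff₀ (by positivity)]
    linarith

/-- The left side is the interpolation error with the derivative bound of order $N+1$, whence
$2N+3=2(N+1)+1$. Stirling supplies only the power $N+1$ of $(N+1)/e$; the missing factor $4(N+1)/e$
is paid for by the product of the two square roots, at least $2\pi(N+1)$. -/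
theorem chebyshev_error_le_rate {c : ℝ} (hc : 0 < c) (N : ℕ) :
    c ^ (N + 1) * Real.sqrt c / Real.sqrt (Real.pi * (2 * N + 3)) / ((N + 1).factorial * 2 ^ N) ≤
      etaRate 1 c N := by
  have hN : (0 : ℝ) ≤ N := N.cast_nonneg
  have hpi : (3 : ℝ) < Real.pi := Real.pi_gt_three
  have he : 0 < Real.exp 1 := Real.exp_pos 1
  have hst := Stirling.le_factorial_stirling (N + 1)
  push_cast at hst
  set S := Real.sqrt (2 * Real.pi * (N + 1)) with hS
  have hS0 : 0 < S := Real.sqrt_pos.2 (by positivity)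
  have hS2 : S ≤ Real.sqrt (Real.pi * (2 * N + 3)) :=
    Real.sqrt_le_sqrt (by nlinarith)
  have hSS : S * S = 2 * Real.pi * (N + 1) := Real.mul_self_sqrt (by positivity)
  have hrate : etaRate 1 c N =
      c ^ (N + 1) * Real.sqrt c * (Real.exp 1 / (2 * N + 2)) ^ (N + 2) := by
    have hsq : Real.sqrt c * Real.sqrt c = c := Real.mul_self_sqrt hc.le
    have hs0 : 0 < Real.sqrt c := Real.sqrt_pos.2 hc
    rw [etaRate, mul_one, Real.rpow_neg hc.le, ← Real.sqrt_eq_rpow, mul_div_right_comm, mul_pow,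
      pow_succ c (N + 1)]
    field_simp
    rw [Real.sq_sqrt hc.le]
  rw [hrate, div_div, div_eq_mul_inv]
  refine mul_le_mul_of_nonneg_left ?_ (by positivity)
  rw [inv_le_comm₀ (by positivity) (by positivity), ← inv_pow, inv_div]
  have h1 : S * (S * (((N : ℝ) + 1) / Real.exp 1) ^ (N + 1) * 2 ^ N) ≤
      Real.sqrt (Real.pi * (2 * N + 3)) * ((N + 1).factorial * 2 ^ N) := by gcongr
  refine le_trans ?_ h1
  have h2 : S * (S * (((N : ℝ) + 1) / Real.exp 1) ^ (N + 1) * 2 ^ N) =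
      (S * S) * ((((N : ℝ) + 1) / Real.exp 1) ^ (N + 1) * 2 ^ N) := by ring
  have h3 : ((2 * (N : ℝ) + 2) / Real.exp 1) ^ (N + 2) =
      (4 * (N + 1) / Real.exp 1) * ((((N : ℝ) + 1) / Real.exp 1) ^ (N + 1) * 2 ^ N) := by
    rw [show (2 * (N : ℝ) + 2) / Real.exp 1 = 2 * ((N + 1) / Real.exp 1) by ring, mul_pow]
    ring
  rw [h2, h3, hSS]
  refine mul_le_mul_of_nonneg_right ?_ (by positivity)
  rw [div_le_iff₀ he]
  have he1 : 1 ≤ Real.exp 1 := Real.one_le_exp zero_le_one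
  have : 4 * ((N : ℝ) + 1) ≤ 2 * Real.pi * (N + 1) := by nlinarith
  nlinarith [mul_nonneg (by positivity : (0 : ℝ) ≤ 2 * Real.pi * (N + 1)) (sub_nonneg.2 he1)]

/-! ### Bandlimited functions: Fourier inversion and derivative bounds. -/

/-- An `L²` function whose Plancherel transform is integrable is almost everywhere the inverse
Fourier integral of that transform. -/
theorem ae_eq_fourierInv_of_integrable (u : Lp ℂ 2 (volume : Measure ℝ))
    (hint : Integrable (fun ξ => (𝓕 u : Lp ℂ 2 (volume : Measure ℝ)) ξ)) :
    ∀ᵐ x, u x = 𝓕⁻ (fun ξ => (𝓕 u : Lp ℂ 2 (volume : Measure ℝ)) ξ) x := by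
  set φ : Lp ℂ 2 (volume : Measure ℝ) := 𝓕 u with hφ
  have hcont : Continuous (𝓕⁻ (fun ξ => φ ξ) : ℝ → ℂ) := by
    have h := VectorFourier.fourierIntegral_continuous (μ := (volume : Measure ℝ))
      (L := -innerₗ ℝ) Real.continuous_fourierChar (by
        simp only [LinearMap.neg_apply, innerₗ_apply_apply]
        exact continuous_inner.neg) hint
    refine h.congr fun x => ?_
    simp [VectorFourier.fourierIntegral, Real.fourierInv_eq]
  -- Both sides are tested against smooth compactly supported $g$: the inverse transform moves onto
  -- $g$ by duality of tempered distributions, and back by Fubini.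
  refine ae_eq_of_integral_contDiff_smul_eq ((Lp.memLp u).locallyIntegrable (by norm_num))
    hcont.locallyIntegrable fun g hg hgc => ?_
  have hg₁ : HasCompactSupport (Complex.ofRealCLM ∘ g) := hgc.comp_left rfl
  have hg₂ : ContDiff ℝ (⊤ : ℕ∞) (Complex.ofRealCLM ∘ g) := by fun_prop
  set G : SchwartzMap ℝ ℂ := hg₁.toSchwartzMap hg₂
  have hG : ∀ x, G x = (g x : ℂ) := fun x => rfl
  have hL : u = 𝓕⁻ φ := by rw [hφ, FourierTransform.fourierInv_fourier_eq]
  calc ∫ x, g x • u x = Lp.toTemperedDistribution u G := by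
        rw [Lp.toTemperedDistribution_apply]; simp [hG]
    _ = (Lp.toTemperedDistribution φ) (𝓕⁻ G) := by
        conv_lhs => rw [hL]
        rw [← Lp.fourierInv_toTemperedDistribution_eq, TemperedDistribution.fourierInv_apply]
    _ = ∫ ξ, (𝓕⁻ G) ξ • φ ξ := Lp.toTemperedDistribution_apply _ _
    _ = ∫ x, G x • 𝓕⁻ (fun ξ => φ ξ) x := by
        -- The pairing $-\langle\cdot,\cdot\rangle$ turns the forward transform into the inverse
        -- one.
        have h := VectorFourier.integral_fourierIntegral_smul_eq_flip (μ := (volume : Measure ℝ))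
          (ν := (volume : Measure ℝ)) (L := -innerₗ ℝ) (e := Real.fourierChar)
          Real.continuous_fourierChar (by
            simp only [LinearMap.neg_apply, innerₗ_apply_apply]
            exact continuous_inner.neg) (G.integrable (μ := volume)) hint
        have e1 : ∀ ξ : ℝ, VectorFourier.fourierIntegral Real.fourierChar volume (-innerₗ ℝ)
            (fun x => G x) ξ = (𝓕⁻ G) ξ := fun ξ => by
          rw [SchwartzMap.fourierInv_coe]
          simp [VectorFourier.fourierIntegral, Real.fourierInv_eq]
        have e2 : ∀ x : ℝ, VectorFourier.fourierIntegral Real.fourierChar volume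
            (-innerₗ ℝ).flip (fun ξ => φ ξ) x = 𝓕⁻ (fun ξ => φ ξ) x := fun x => by
          simp [VectorFourier.fourierIntegral, Real.fourierInv_eq, mul_comm]
        simp only [e1, e2] at h
        exact h
    _ = _ := by simp [hG]

/-- Moments of a compactly supported `L²` function. -/
theorem integrable_pow_smul_of_ae_eq_zero {φ : ℝ → ℂ} (hφ : MemLp φ 2 volume) {b : ℝ}
    (hb : 0 ≤ b) (h0 : ∀ᵐ ξ : ℝ, b < |ξ| → φ ξ = 0) (n : ℕ) :
    Integrable (fun ξ : ℝ => ξ ^ n • φ ξ) ∧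
      ∫ ξ : ℝ, |ξ| ^ n * ‖φ ξ‖ ≤
        Real.sqrt (2 * b ^ (2 * n + 1) / (2 * n + 1)) * (eLpNorm φ 2 volume).toReal := by
  -- Truncating the monomial to the band puts it in $L^2$ without changing the product with
  -- $\varphi$, so Hölder with exponents $2,2$ applies.
  set k : ℝ → ℝ := (Icc (-b) b).indicator fun ξ => ξ ^ n with hk
  have hkm : MemLp k 2 volume := by
    rw [hk, memLp_indicator_iff_restrict measurableSet_Icc]
    refine MemLp.of_bound (by fun_prop) (b ^ n) ?_
    filter_upwards [ae_restrict_mem measurableSet_Icc] with ξ hξ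
    rw [norm_pow, Real.norm_eq_abs]
    exact pow_le_pow_left₀ (abs_nonneg _) (abs_le.2 hξ) n
  have hae : ∀ᵐ ξ : ℝ, ξ ^ n • φ ξ = k ξ • φ ξ := by
    filter_upwards [h0] with ξ hξ
    by_cases h : ξ ∈ Icc (-b) b
    · rw [hk, indicator_of_mem h]
    · rw [hξ (lt_of_not_ge fun h' => h (abs_le.1 h')), smul_zero, smul_zero]
  refine ⟨(integrable_congr hae).2 (memLp_one_iff_integrable.1 (hφ.smul hkm)), ?_⟩
  have h1 : ∫ ξ : ℝ, |ξ| ^ n * ‖φ ξ‖ = ∫ ξ : ℝ, ‖(k ξ : ℂ)‖ * ‖φ ξ‖ := by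
    refine integral_congr_ae ?_
    filter_upwards [hae] with ξ hξ
    have := congrArg norm hξ
    rw [norm_smul, norm_smul, norm_pow, Real.norm_eq_abs] at this
    rw [this, Complex.norm_real]
  have h2 := integral_mul_norm_le_Lp_mul_Lq (μ := (volume : Measure ℝ)) (p := 2) (q := 2)
    (f := fun ξ => (k ξ : ℂ)) (g := φ) Real.HolderConjugate.two_two
    (by simpa using hkm.ofReal (K := ℂ)) (by simpa using hφ)
  have h3 : ∫ ξ : ℝ, ‖(k ξ : ℂ)‖ ^ (2 : ℝ) = 2 * b ^ (2 * n + 1) / (2 * n + 1) := by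
    have e : ∀ ξ, ‖(k ξ : ℂ)‖ ^ (2 : ℝ) = (Icc (-b) b).indicator (fun ξ => ξ ^ (2 * n)) ξ := by
      intro ξ
      rw [Real.rpow_two, Complex.norm_real, Real.norm_eq_abs, sq_abs, hk]
      by_cases h : ξ ∈ Icc (-b) b
      · rw [indicator_of_mem h, indicator_of_mem h, ← pow_mul, mul_comm]
      · rw [indicator_of_notMem h, indicator_of_notMem h]; simp
    simp only [e]
    rw [integral_indicator measurableSet_Icc, integral_Icc_eq_integral_Ioc,
      ← intervalIntegral.integral_of_le (by linarith), integral_pow]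
    push_cast
    rw [Odd.neg_pow ⟨n, rfl⟩]
    ring
  have h4 : (eLpNorm φ 2 volume).toReal = (∫ ξ : ℝ, ‖φ ξ‖ ^ (2 : ℝ)) ^ (1 / 2 : ℝ) := by
    rw [hφ.eLpNorm_eq_integral_rpow_norm (by norm_num) (by norm_num), ENNReal.toReal_ofReal
      (by positivity)]
    simp
  rw [h1, h4, Real.sqrt_eq_rpow, ← h3]
  exact h2

theorem iteratedDeriv_re {h : ℝ → ℂ} (n : ℕ) (hh : ContDiff ℝ n h) (x : ℝ) :
    iteratedDeriv n (fun y => (h y).re) x = (iteratedDeriv n h x).re := by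
  rw [iteratedDeriv_eq_iteratedFDeriv, iteratedDeriv_eq_iteratedFDeriv]
  have := Complex.reCLM.iteratedFDeriv_comp_left (f := h) (x := x) hh.contDiffAt (i := n) le_rfl
  change iteratedFDeriv ℝ n (Complex.reCLM ∘ h) x _ = _
  rw [this]
  rfl

/-- A bandlimited function is smooth up to a null set, with derivatives bounded in terms of its
`L²` norm. -/
theorem IsBandlimited.exists_contDiff {c : ℝ} (hc : 0 < c) {g : ℝ → ℂ} (hg : IsBandlimited c g) :
    ∃ h : ℝ → ℝ, ContDiff ℝ (⊤ : ℕ∞) h ∧ (∀ᵐ x, (g x).re = h x) ∧ ∀ (n : ℕ) (x : ℝ),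
      |iteratedDeriv n h x| ≤
        c ^ n * Real.sqrt c / Real.sqrt (Real.pi * (2 * n + 1)) * l2Norm g := by
  obtain ⟨hgm, h0⟩ := hg
  set φ : Lp ℂ 2 (volume : Measure ℝ) := 𝓕 (hgm.toLp g) with hφ
  have hpi := Real.pi_pos
  -- The band edge in ordinary rather than angular frequency.
  set b : ℝ := c / (2 * Real.pi) with hb
  have hb0 : 0 < b := by positivity
  have h0' : ∀ᵐ ξ : ℝ, b < |ξ| → φ ξ = 0 := by
    filter_upwards [h0] with ξ hξ hbξ
    refine hξ ?_
    rw [abs_mul, abs_of_pos (by positivity : (0 : ℝ) < 2 * Real.pi)]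
    rw [hb, div_lt_iff₀ (by positivity)] at hbξ
    linarith
  have hnorm : (eLpNorm φ 2 volume).toReal = l2Norm g := by
    rw [← Lp.norm_def, hφ, Lp.norm_fourier_eq, Lp.norm_toLp, l2Norm]
  have hmom := integrable_pow_smul_of_ae_eq_zero (Lp.memLp φ) hb0.le h0'
  have hint : Integrable (fun ξ => φ ξ) := by simpa using (hmom 0).1
  -- Reflection rewrites the inverse transform of $\varphi$ as a forward transform, to which the
  -- differentiation formulas apply.
  set ψ : ℝ → ℂ := fun ξ => φ (-ξ) with hψ
  have hψint : ∀ n : ℕ, Integrable fun ξ : ℝ => ξ ^ n • ψ ξ := fun n => by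
    have h := ((hmom n).1.comp_neg).const_mul ((-1 : ℂ) ^ n)
    refine h.congr (Filter.Eventually.of_forall fun ξ => ?_)
    simp only [hψ, Complex.real_smul]
    push_cast
    rw [← mul_assoc, ← mul_pow]
    simp
  have hF : (𝓕⁻ (fun ξ => φ ξ) : ℝ → ℂ) = 𝓕 ψ := by
    ext x
    rw [Real.fourierInv_eq_fourier_comp_neg]
  have hsm : ContDiff ℝ (⊤ : ℕ∞) (𝓕 ψ) := by
    refine Real.contDiff_fourier (N := ⊤) fun n _ => ?_
    refine (hψint n).norm.congr (Filter.Eventually.of_forall fun ξ => ?_)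
    simp
  refine ⟨fun x => (𝓕 ψ x).re, Complex.reCLM.contDiff.comp hsm, ?_, fun n x => ?_⟩
  · filter_upwards [ae_eq_fourierInv_of_integrable (hgm.toLp g) hint, hgm.coeFn_toLp] with x h1 h2
    rw [← h2, h1]
    exact congrArg Complex.re (congrFun hF x)
  · rw [iteratedDeriv_re n (hsm.of_le (by exact_mod_cast le_top))]
    refine (Complex.abs_re_le_norm _).trans ?_
    rw [Real.iteratedDeriv_fourier (N := ⊤) (fun n _ => hψint n) le_top]
    have h1 : ‖𝓕 (fun ξ : ℝ => (-2 * Real.pi * Complex.I * ξ) ^ n • ψ ξ) x‖ ≤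
        ∫ ξ : ℝ, ‖(-2 * Real.pi * Complex.I * ξ) ^ n • ψ ξ‖ :=
      VectorFourier.norm_fourierIntegral_le_integral_norm _ _ _ _ _
    refine h1.trans ?_
    have h2 : ∀ ξ : ℝ, ‖(-2 * (Real.pi : ℂ) * Complex.I * ξ) ^ n • ψ ξ‖ =
        (2 * Real.pi) ^ n * ((fun ξ => |ξ| ^ n * ‖φ ξ‖) (-ξ)) := fun ξ => by
      simp [mul_pow, abs_of_pos hpi, hψ]
      ring
    simp only [h2]
    rw [integral_const_mul, integral_neg_eq_self (fun ξ : ℝ => |ξ| ^ n * ‖φ ξ‖)]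
    refine (mul_le_mul_of_nonneg_left (hmom n).2 (by positivity)).trans (le_of_eq ?_)
    rw [hnorm, ← mul_assoc]
    congr 1
    have e1 : 2 * b ^ (2 * n + 1) / (2 * n + 1) =
        (b ^ n) ^ 2 * (c / (Real.pi * (2 * n + 1))) := by
      rw [pow_succ, mul_comm 2 n, pow_mul, hb]
      field_simp
    rw [e1, Real.sqrt_mul (by positivity), Real.sqrt_sq (by positivity), Real.sqrt_div hc.le,
      ← mul_assoc, ← mul_pow, hb, mul_div_cancel₀ _ (by positivity)]
    ring

/-! ### The weighted $L^2$ norm. -/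

theorem weight_nonneg (α β : ℝ) {x : ℝ} (hx : x ∈ Icc (-1 : ℝ) 1) : 0 ≤ weight α β x :=
  mul_nonneg (Real.rpow_nonneg (by linarith [hx.2]) _) (Real.rpow_nonneg (by linarith [hx.1]) _)

theorem measurable_weight (α β : ℝ) : Measurable (weight α β) := by
  unfold weight
  fun_prop

theorem weightMeasure_absolutelyContinuous (α β : ℝ) :
    weightMeasure α β ≪ volume.restrict (Icc (-1 : ℝ) 1) :=
  withDensity_absolutelyContinuous _ _

theorem integrableOn_weight {α β : ℝ} (hα : -1 < α) (hβ : -1 < β) :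
    IntegrableOn (weight α β) (Icc (-1) 1) := by
  rw [integrableOn_Icc_iff_integrableOn_Ioc,
    ← intervalIntegrable_iff_integrableOn_Ioc_of_le (by norm_num)]
  exact intervalIntegrable_weight hα hβ

theorem weightMeasure_univ {α β : ℝ} (hα : -1 < α) (hβ : -1 < β) :
    weightMeasure α β univ = ENNReal.ofReal (gammaConst α β) := by
  rw [weightMeasure, withDensity_apply _ MeasurableSet.univ, Measure.restrict_univ,
    ← ofReal_integral_eq_lintegral_ofReal (integrableOn_weight hα hβ), ← integral_weight hα hβ,
    intervalIntegral.integral_of_le (by norm_num), integral_Icc_eq_integral_Ioc]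
  filter_upwards [ae_restrict_mem measurableSet_Icc] with x hx using weight_nonneg α β hx

theorem isFiniteMeasure_weightMeasure {α β : ℝ} (hα : -1 < α) (hβ : -1 < β) :
    IsFiniteMeasure (weightMeasure α β) :=
  ⟨by rw [weightMeasure_univ hα hβ]; exact ENNReal.ofReal_lt_top⟩

theorem integral_weightMeasure (α β : ℝ) (g : ℝ → ℝ) :
    ∫ x, g x ∂(weightMeasure α β) = ∫ x in (-1 : ℝ)..1, weight α β x * g x := by
  rw [weightMeasure, integral_withDensity_eq_integral_toReal_smul
    (measurable_weight α β).ennreal_ofReal (by simp), intervalIntegral.integral_of_le (by norm_num),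
    ← integral_Icc_eq_integral_Ioc]
  refine setIntegral_congr_fun measurableSet_Icc fun x hx => ?_
  rw [ENNReal.toReal_ofReal (weight_nonneg α β hx), smul_eq_mul]

theorem ae_weightMeasure_mem_Icc (α β : ℝ) :
    ∀ᵐ x ∂(weightMeasure α β), x ∈ Icc (-1 : ℝ) 1 :=
  (weightMeasure_absolutelyContinuous α β).ae_le (ae_restrict_mem measurableSet_Icc)

theorem memLp_weightMeasure_of_continuous {α β : ℝ} (hα : -1 < α) (hβ : -1 < β) {g : ℝ → ℝ}
    (hg : Continuous g) : MemLp g 2 (weightMeasure α β) := by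
  have := isFiniteMeasure_weightMeasure hα hβ
  obtain ⟨K, hK⟩ := isCompact_Icc.exists_bound_of_continuousOn
    (hg.continuousOn (s := Icc (-1 : ℝ) 1))
  refine MemLp.of_bound hg.aestronglyMeasurable K ?_
  filter_upwards [ae_weightMeasure_mem_Icc α β] with x hx using hK x hx

theorem weightedNorm_le_of_bound {α β : ℝ} (hα : -1 < α) (hβ : -1 < β) {g : ℝ → ℝ} {K : ℝ}
    (hK : ∀ x ∈ Icc (-1 : ℝ) 1, |g x| ≤ K) :
    weightedNorm α β g ≤ Real.sqrt (gammaConst α β) * K := by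
  have hK0 : 0 ≤ K := (abs_nonneg _).trans (hK 0 (by norm_num))
  have h : eLpNorm g 2 (weightMeasure α β) ≤
      (weightMeasure α β univ) ^ (2 : ℝ≥0∞).toReal⁻¹ * ENNReal.ofReal K :=
    eLpNorm_le_of_ae_bound ((ae_weightMeasure_mem_Icc α β).mono fun x hx => hK x hx)
  rw [weightMeasure_univ hα hβ] at h
  have h2 := ENNReal.toReal_mono (ENNReal.mul_ne_top
    (ENNReal.rpow_ne_top_of_nonneg (by simp) ENNReal.ofReal_ne_top) ENNReal.ofReal_ne_top) h
  rw [ENNReal.toReal_mul, ← ENNReal.toReal_rpow, ENNReal.toReal_ofReal hK0,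
    ENNReal.toReal_ofReal (gammaConst_pos hα hβ).le] at h2
  rw [Real.sqrt_eq_rpow]
  simpa [weightedNorm] using h2

theorem weightedNorm_add_le {α β : ℝ} (hα : -1 < α) (hβ : -1 < β) {g₁ g₂ : ℝ → ℝ}
    (h₁ : Continuous g₁) (h₂ : Continuous g₂) :
    weightedNorm α β (g₁ + g₂) ≤ weightedNorm α β g₁ + weightedNorm α β g₂ := by
  have m₁ := memLp_weightMeasure_of_continuous hα hβ h₁
  have m₂ := memLp_weightMeasure_of_continuous hα hβ h₂
  rw [weightedNorm, weightedNorm, weightedNorm, ← ENNReal.toReal_add m₁.2.ne m₂.2.ne]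
  exact ENNReal.toReal_mono (ENNReal.add_ne_top.2 ⟨m₁.2.ne, m₂.2.ne⟩)
    (eLpNorm_add_le m₁.1 m₂.1 (by norm_num))

/-- Parseval's identity for the orthonormal family. -/
theorem weightedNorm_sum_normJacobi {α β : ℝ} (hα : -1 < α) (hβ : -1 < β) {N : ℕ}
    (v : Fin (N + 1) → ℝ) :
    weightedNorm α β (fun t => ∑ k : Fin (N + 1), v k * normJacobi α β k t) =
      ‖(WithLp.toLp 2 v : EuclideanSpace ℝ (Fin (N + 1)))‖ := by
  have hc : Continuous fun t => ∑ k : Fin (N + 1), v k * normJacobi α β k t :=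
    continuous_finsetSum _ fun k _ => continuous_const.mul (continuous_normJacobi α β k)
  have e1 : weightedNorm α β (fun t => ∑ k : Fin (N + 1), v k * normJacobi α β k t) =
      Real.sqrt (∫ t in (-1 : ℝ)..1, weight α β t *
        (∑ k : Fin (N + 1), v k * normJacobi α β k t) ^ 2) := by
    rw [weightedNorm, (memLp_weightMeasure_of_continuous hα hβ hc).eLpNorm_eq_integral_rpow_norm
      (by norm_num) (by norm_num), ENNReal.toReal_ofReal (by positivity), Real.sqrt_eq_rpow,
      ← integral_weightMeasure]
    simp
  have e2 : ∫ t in (-1 : ℝ)..1, weight α β t *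
      (∑ k : Fin (N + 1), v k * normJacobi α β k t) ^ 2 = ∑ k : Fin (N + 1), v k ^ 2 := by
    have e : ∀ t, weight α β t * (∑ k : Fin (N + 1), v k * normJacobi α β k t) ^ 2 =
        ∑ j : Fin (N + 1), ∑ k : Fin (N + 1), v j * v k *
          (weight α β t * (normJacobi α β j t * normJacobi α β k t)) := fun t => by
      rw [sq, Finset.sum_mul_sum, Finset.mul_sum]
      refine Finset.sum_congr rfl fun j _ => ?_
      rw [Finset.mul_sum]
      exact Finset.sum_congr rfl fun k _ => by ring
    have hi : ∀ j k : Fin (N + 1), IntervalIntegrable (fun t => v j * v k *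
        (weight α β t * (normJacobi α β j t * normJacobi α β k t))) volume (-1) 1 := fun j k =>
      (intervalIntegrable_weight_mul hα hβ ((continuous_normJacobi α β j).mul
        (continuous_normJacobi α β k)).continuousOn).const_mul _
    simp only [e]
    rw [intervalIntegral.integral_finsetSum fun j _ => by
      convert! IntervalIntegrable.sum Finset.univ fun k _ => hi j k using 1
      ext t
      simp]
    refine Finset.sum_congr rfl fun j _ => ?_
    rw [intervalIntegral.integral_finsetSum fun k _ => hi j k]
    simp only [intervalIntegral.integral_const_mul, integral_weight_mul_normJacobi hα hβ,
      Fin.val_inj]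
    simp [sq]
  rw [e1, e2, EuclideanSpace.norm_eq]
  simp

theorem normJacobi_zero {α β : ℝ} (hα : -1 < α) (hβ : -1 < β) (x : ℝ) :
    normJacobi α β 0 x = 1 / Real.sqrt (gammaConst α β) := by
  have h : jacobiSqNorm α β 0 = gammaConst α β := by
    rw [← integral_weight_mul_jacobi_sq hα hβ 0, ← integral_weight hα hβ]
    simp [jacobi]
  rw [normJacobi, h]
  simp [jacobi]

/-! ### The Gram matrix and the stability of least squares. -/

theorem projMatrix_mulVec (α β : ℝ) (N : ℕ) {n : ℕ} (x : Fin n → ℝ) (v : Fin (N + 1) → ℝ)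
    (j : Fin n) :
    (projMatrix α β N x).mulVec v j =
      1 / Real.sqrt n * ∑ k : Fin (N + 1), v k * normJacobi α β k (x j) := by
  simp only [Matrix.mulVec, dotProduct, projMatrix, Matrix.of_apply, Finset.mul_sum]
  exact Finset.sum_congr rfl fun k _ => by ring

/-- The Gram matrix is invertible as soon as the `n ≥ N + 1` nodes are distinct. -/
theorem isUnit_det_gramMatrix {α β : ℝ} (hα : -1 < α) (hβ : -1 < β) {N n : ℕ} (hn : N + 1 ≤ n)
    {x : Fin n → ℝ} (hx : Function.Injective x) : IsUnit (gramMatrix α β N x).det := by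
  rw [isUnit_iff_ne_zero]
  intro hdet
  obtain ⟨v, hv, hAv⟩ := Matrix.exists_mulVec_eq_zero_iff.2 hdet
  refine hv ?_
  have hBv : (projMatrix α β N x).mulVec v = 0 := by
    rw [gramMatrix, ← Matrix.mulVec_mulVec] at hAv
    have := congrArg (fun w => dotProduct v w) hAv
    rw [dotProduct_zero, Matrix.dotProduct_mulVec, Matrix.vecMul_transpose] at this
    exact dotProduct_self_eq_zero.1 this
  -- A kernel vector of $B_N$ gives a polynomial of degree at most $N$ with $n>N$ zeros; it
  -- vanishes, and Parseval then kills the vector.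
  set p : Polynomial ℝ := ∑ k : Fin (N + 1),
    Polynomial.C (v k * (Real.sqrt (jacobiSqNorm α β k))⁻¹) * jacobi α β k with hp
  have hpe : ∀ t, p.eval t = ∑ k : Fin (N + 1), v k * normJacobi α β k t := fun t => by
    simp only [hp, Polynomial.eval_finsetSum, Polynomial.eval_mul, Polynomial.eval_C, normJacobi]
    exact Finset.sum_congr rfl fun k _ => by ring
  have hn0 : (0 : ℝ) < n := by exact_mod_cast (by omega : 0 < n)
  have hroot : ∀ j, p.eval (x j) = 0 := fun j => by
    have h := congrFun hBv j
    rw [projMatrix_mulVec, ← hpe, Pi.zero_apply] at h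
    exact (mul_eq_zero.1 h).resolve_left (one_div_ne_zero (Real.sqrt_pos.2 hn0).ne')
  have hdeg : p.natDegree ≤ N := Polynomial.natDegree_sum_le_of_forall_le _ _ fun k _ =>
    (Polynomial.natDegree_C_mul_le _ _).trans ((natDegree_jacobi_le α β k).trans
      (Nat.lt_succ_iff.1 k.2))
  have hp0 : p = 0 := by
    refine Polynomial.eq_zero_of_natDegree_lt_card_of_eval_eq_zero p hx hroot ?_
    rw [Fintype.card_fin]
    omega
  have h := weightedNorm_sum_normJacobi hα hβ v
  simp only [← hpe, hp0, Polynomial.eval_zero] at h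
  have h0 : ‖(WithLp.toLp 2 v : EuclideanSpace ℝ (Fin (N + 1)))‖ = 0 := by
    rw [← h, weightedNorm]
    simp
  simpa using h0

-- For $D=A^{-1}B'$ one has $DD'=A^{-1}$, so the $C^*$-identity gives $\|D\|^2=\|A^{-1}\|$.
open scoped Matrix.Norms.L2Operator in
theorem norm_inv_mul_transpose_mulVec_le {m n : ℕ} (B : Matrix (Fin n) (Fin m) ℝ)
    (hB : IsUnit (B.transpose * B).det) (R : Fin n → ℝ) :
    ‖(WithLp.toLp 2 ((B.transpose * B)⁻¹.mulVec (B.transpose.mulVec R)) :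
      EuclideanSpace ℝ (Fin m))‖ ≤
      Real.sqrt ‖Matrix.toEuclideanCLM (n := Fin m) (𝕜 := ℝ) (B.transpose * B)⁻¹‖ *
        ‖(WithLp.toLp 2 R : EuclideanSpace ℝ (Fin n))‖ := by
  set A := B.transpose * B with hA
  set D : Matrix (Fin m) (Fin n) ℝ := A⁻¹ * B.transpose with hD
  have hAt : A.transpose = A := by rw [hA, Matrix.transpose_mul, Matrix.transpose_transpose]
  have hDD : D * D.transpose = A⁻¹ := by
    rw [hD, Matrix.transpose_mul, Matrix.transpose_transpose, Matrix.transpose_nonsing_inv, hAt,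
      Matrix.mul_assoc, ← Matrix.mul_assoc B.transpose, ← hA, Matrix.mul_nonsing_inv A hB,
      Matrix.mul_one]
  have h1 := Matrix.l2_opNorm_conjTranspose_mul_self D.conjTranspose
  rw [Matrix.conjTranspose_conjTranspose, Matrix.l2_opNorm_conjTranspose,
    Matrix.conjTranspose_eq_transpose_of_trivial, hDD] at h1
  have h2 : Real.sqrt ‖Matrix.toEuclideanCLM (n := Fin m) (𝕜 := ℝ) A⁻¹‖ = ‖D‖ := by
    rw [Matrix.l2_opNorm_toEuclideanCLM, h1, Real.sqrt_mul_self (norm_nonneg _)]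
  rw [h2, Matrix.mulVec_mulVec]
  exact Matrix.l2_opNorm_mulVec D (WithLp.toLp 2 R)

theorem apply_le_norm_toEuclideanCLM {m : ℕ} (A : Matrix (Fin m) (Fin m) ℝ) (i : Fin m) :
    A i i ≤ ‖Matrix.toEuclideanCLM (n := Fin m) (𝕜 := ℝ) A‖ := by
  set e : EuclideanSpace ℝ (Fin m) := EuclideanSpace.single i 1
  have he : ‖e‖ = 1 := by simp [e]
  have h1 : inner ℝ e (Matrix.toEuclideanCLM (n := Fin m) (𝕜 := ℝ) A e) = A i i := by
    rw [Matrix.inner_toEuclideanCLM]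
    simp [e]
  rw [← h1]
  refine (real_inner_le_norm _ _).trans ?_
  rw [he, one_mul]
  simpa [he] using (Matrix.toEuclideanCLM (n := Fin m) (𝕜 := ℝ) A).le_opNorm e

/-- The $(0,0)$ entry of $A_N$ is exactly $1/\gamma$, whatever the nodes. This lower bound on
$\|A_N\|$ lets the condition number replace $\|A_N^{-1}\|$. -/
theorem inv_gammaConst_le_norm_gramMatrix {α β : ℝ} (hα : -1 < α) (hβ : -1 < β) (N : ℕ) {n : ℕ}
    (hn : 0 < n) (x : Fin n → ℝ) :
    (gammaConst α β)⁻¹ ≤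
      ‖Matrix.toEuclideanCLM (n := Fin (N + 1)) (𝕜 := ℝ) (gramMatrix α β N x)‖ := by
  have hn0 : (0 : ℝ) < n := by exact_mod_cast hn
  have hγ := gammaConst_pos hα hβ
  refine le_trans (le_of_eq ?_) (apply_le_norm_toEuclideanCLM _ 0)
  simp only [gramMatrix, Matrix.mul_apply, Matrix.transpose_apply, projMatrix, Matrix.of_apply,
    Fin.val_zero, normJacobi_zero hα hβ, Finset.sum_const, Finset.card_univ, Fintype.card_fin,
    nsmul_eq_mul]
  have h1 := Real.mul_self_sqrt hn0.le
  have h2 := Real.mul_self_sqrt hγ.le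
  have h3 : 1 / Real.sqrt n * (1 / Real.sqrt (gammaConst α β)) *
      (1 / Real.sqrt n * (1 / Real.sqrt (gammaConst α β))) = 1 / (n * gammaConst α β) := by
    conv_rhs => rw [← h1, ← h2]
    ring
  rw [h3]
  field_simp

theorem norm_div_sqrt_le {n : ℕ} (hn : 0 < n) {r : Fin n → ℝ} {K : ℝ} (hr : ∀ j, |r j| ≤ K) :
    ‖(WithLp.toLp 2 (fun j => 1 / Real.sqrt n * r j) : EuclideanSpace ℝ (Fin n))‖ ≤ K := by
  have hn0 : (0 : ℝ) < n := by exact_mod_cast hn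
  have hK : 0 ≤ K := (abs_nonneg _).trans (hr ⟨0, hn⟩)
  rw [EuclideanSpace.norm_eq]
  refine Real.sqrt_le_iff.2 ⟨hK, ?_⟩
  calc ∑ j, ‖1 / Real.sqrt n * r j‖ ^ 2 ≤ ∑ _j : Fin n, 1 / n * K ^ 2 := by
        refine Finset.sum_le_sum fun j _ => ?_
        rw [Real.norm_eq_abs, sq_abs, mul_pow, div_pow, Real.sq_sqrt hn0.le, one_pow]
        refine mul_le_mul_of_nonneg_left ?_ (by positivity)
        rw [← sq_abs]
        exact pow_le_pow_left₀ (abs_nonneg _) (hr j) 2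
    _ = K ^ 2 := by
        rw [Finset.sum_const, Finset.card_univ, Fintype.card_fin, nsmul_eq_mul]
        field_simp

/-- Least squares is linear and reproduces polynomials of degree at most $N$; only the residuals
pass through $A_N^{-1}B_N'$. -/
theorem coeffs_eq_add {α β : ℝ} {N n : ℕ} {x : Fin n → ℝ}
    (hdet : IsUnit (gramMatrix α β N x).det) (d : Fin (N + 1) → ℝ) (r : Fin n → ℝ) :
    coeffs α β N x (fun j => (∑ k : Fin (N + 1), d k * normJacobi α β k (x j)) + r j) =
      d + (gramMatrix α β N x)⁻¹.mulVec
        ((projMatrix α β N x).transpose.mulVec fun j => 1 / Real.sqrt n * r j) := by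
  have e : (fun j => 1 / Real.sqrt n *
      ((∑ k : Fin (N + 1), d k * normJacobi α β k (x j)) + r j)) =
      (projMatrix α β N x).mulVec d + fun j => 1 / Real.sqrt n * r j := by
    ext j
    rw [Pi.add_apply, projMatrix_mulVec]
    ring
  rw [coeffs, e, Matrix.mulVec_add, Matrix.mulVec_add, Matrix.mulVec_mulVec,
    Matrix.mulVec_mulVec, Matrix.mul_assoc,
    show (projMatrix α β N x).transpose * projMatrix α β N x = gramMatrix α β N x from rfl,
    Matrix.nonsing_inv_mul _ hdet, Matrix.one_mulVec]

/-- Stability of the least squares estimator: its error is controlled by the uniform error of any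
polynomial approximation of degree at most `N`, the noise, and the condition number. -/
theorem weightedNorm_sub_estimator_le {α β : ℝ} (hα : -1 < α) (hβ : -1 < β) {N n : ℕ} (hn : 0 < n)
    {x ε : Fin n → ℝ} (hdet : IsUnit (gramMatrix α β N x).det) (hxI : ∀ j, x j ∈ Icc (-1 : ℝ) 1)
    {h : ℝ → ℝ} (hh : Continuous h) {q : Polynomial ℝ} (hq : q.natDegree ≤ N) {K E : ℝ}
    (hK : ∀ t ∈ Icc (-1 : ℝ) 1, |h t - q.eval t| ≤ K) (hE : ∀ j, |ε j| ≤ E) :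
    weightedNorm α β (fun t => h t - estimator α β N x (fun j => h (x j) + ε j) t) ≤
      Real.sqrt (gammaConst α β) * K +
        Real.sqrt (condNumber (gramMatrix α β N x)) * (Real.sqrt (gammaConst α β) * (K + E)) := by
  obtain ⟨d, hd⟩ := exists_eval_eq_sum_normJacobi hα hβ N q hq
  set r : Fin n → ℝ := fun j => h (x j) - q.eval (x j) + ε j with hr
  set v := (gramMatrix α β N x)⁻¹.mulVec
    ((projMatrix α β N x).transpose.mulVec fun j => 1 / Real.sqrt n * r j) with hv
  have hco : coeffs α β N x (fun j => h (x j) + ε j) = d + v := by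
    rw [hv, ← coeffs_eq_add hdet d r]
    congr 1
    ext j
    simp only [hr, hd]
    ring
  have hsplit : (fun t => h t - estimator α β N x (fun j => h (x j) + ε j) t) =
      (fun t => h t - q.eval t) + fun t => ∑ k : Fin (N + 1), (-v) k * normJacobi α β k t := by
    ext t
    simp only [estimator, hco, Pi.add_apply, Pi.neg_apply, hd t, add_mul, neg_mul,
      Finset.sum_add_distrib, Finset.sum_neg_distrib]
    ring
  rw [hsplit]
  have c₁ : Continuous fun t => h t - q.eval t := hh.sub q.continuous
  have c₂ : Continuous fun t => ∑ k : Fin (N + 1), (-v) k * normJacobi α β k t :=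
    continuous_finsetSum _ fun k _ => continuous_const.mul (continuous_normJacobi α β k)
  refine (weightedNorm_add_le hα hβ c₁ c₂).trans ?_
  refine add_le_add (weightedNorm_le_of_bound hα hβ hK) ?_
  rw [weightedNorm_sum_normJacobi hα hβ, WithLp.toLp_neg, norm_neg]
  have hrK : ∀ j, |r j| ≤ K + E := fun j =>
    (abs_add_le _ _).trans (add_le_add (hK _ (hxI j)) (hE j))
  have hKE : 0 ≤ K + E := (abs_nonneg _).trans (hrK ⟨0, hn⟩)
  refine (norm_inv_mul_transpose_mulVec_le (projMatrix α β N x) hdet _).trans ?_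
  have hγ := gammaConst_pos hα hβ
  have hA := inv_gammaConst_le_norm_gramMatrix hα hβ N hn x
  -- Multiplying by this quantity completes $\|A_N^{-1}\|^{1/2}$ to $\sqrt{\kappa_2}\sqrt\gamma$.
  have h1 : 1 ≤ Real.sqrt ‖Matrix.toEuclideanCLM (n := Fin (N + 1)) (𝕜 := ℝ)
      (gramMatrix α β N x)‖ * Real.sqrt (gammaConst α β) := by
    rw [← Real.sqrt_mul (norm_nonneg _), Real.one_le_sqrt]
    rwa [inv_le_iff_one_le_mul₀ hγ] at hA
  refine (mul_le_mul_of_nonneg_left (norm_div_sqrt_le hn hrK) (Real.sqrt_nonneg _)).trans ?_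
  rw [condNumber, Real.sqrt_mul (norm_nonneg _)]
  calc _ ≤ (Real.sqrt ‖Matrix.toEuclideanCLM (n := Fin (N + 1)) (𝕜 := ℝ)
      (gramMatrix α β N x)⁻¹‖ * (K + E)) * (Real.sqrt ‖Matrix.toEuclideanCLM (n := Fin (N + 1))
        (𝕜 := ℝ) (gramMatrix α β N x)‖ * Real.sqrt (gammaConst α β)) :=
        le_mul_of_one_le_right (mul_nonneg (Real.sqrt_nonneg _) hKE) h1
    _ = _ := by ring

/-! ### Almost sure properties of the random nodes. -/

theorem betaLaw_absolutelyContinuous (α β : ℝ) :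
    betaLaw α β ≪ volume.restrict (Icc (-1 : ℝ) 1) :=
  withDensity_absolutelyContinuous _ _

theorem ae_of_hasLaw_betaLaw {Ω : Type*} [MeasurableSpace Ω] {P : Measure Ω} {α β : ℝ}
    {Y : Ω → ℝ} (hY : HasLaw Y (betaLaw α β) P) {p : ℝ → Prop}
    (hp : ∀ᵐ x ∂(volume.restrict (Icc (-1 : ℝ) 1)), p x) : ∀ᵐ w ∂P, p (Y w) :=
  ae_of_ae_map hY.aemeasurable (hY.map_eq ▸ (betaLaw_absolutelyContinuous α β).ae_le hp)

/-- Independent variables with a beta distribution are almost surely distinct. -/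
theorem ae_injective_of_iIndepFun {Ω : Type*} [MeasurableSpace Ω] {P : Measure Ω}
    [IsProbabilityMeasure P] {α β : ℝ} {n : ℕ} {X : Fin n → Ω → ℝ} (hind : iIndepFun X P)
    (hlaw : ∀ i, HasLaw (X i) (betaLaw α β) P) :
    ∀ᵐ w ∂P, Function.Injective fun i => X i w := by
  have h : ∀ i j : Fin n, i ≠ j → ∀ᵐ w ∂P, X i w ≠ X j w := fun i j hij => by
    have hm : P.map (fun w => (X i w, X j w)) = (P.map (X i)).prod (P.map (X j)) :=
      (indepFun_iff_map_prod_eq_prod_map_map (hlaw i).aemeasurable (hlaw j).aemeasurable).1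
        (hind.indepFun hij)
    refine ae_of_ae_map (f := fun w => (X i w, X j w)) (p := fun z => z.1 ≠ z.2)
      ((hlaw i).aemeasurable.prodMk (hlaw j).aemeasurable) ?_
    rw [hm, ae_iff]
    have hs : {z : ℝ × ℝ | ¬ z.1 ≠ z.2} = diagonal ℝ := by ext z; simp
    -- By independence the joint law is a product; each slice of the diagonal is a point, null for
    -- an absolutely continuous law.
    rw [hs, Measure.measure_prod_null measurableSet_diagonal]
    refine Filter.Eventually.of_forall fun y => ?_
    have hy : Prod.mk y ⁻¹' diagonal ℝ = {y} := by ext z; simp [eq_comm]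
    change P.map (X j) (Prod.mk y ⁻¹' diagonal ℝ) = 0
    rw [hy, (hlaw j).map_eq]
    exact betaLaw_absolutelyContinuous α β (measure_singleton y)
  have h' : ∀ᵐ w ∂P, ∀ i j : Fin n, i ≠ j → X i w ≠ X j w := by
    simp only [ae_all_iff]
    exact h
  filter_upwards [h'] with w hw i j hij
  by_contra hne
  exact hw i j hne hij

/-! ### The denominator, and the conclusion. -/

theorem deviation_nonneg {δ : ℝ} (hδ : 0 < δ) (hδ1 : δ < 1) (n : ℕ) : 0 ≤ deviation n δ := by
  have : 0 ≤ Real.log (2 / δ) := Real.log_nonneg (by rw [le_div_iff₀ hδ]; linarith)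
  exact Real.rpow_nonneg (by positivity) _

theorem tendsto_deviation (δ : ℝ) :
    Filter.Tendsto (fun n => deviation n δ) Filter.atTop (nhds 0) := by
  have h := (tendsto_one_div_atTop_nhds_zero_nat (𝕜 := ℝ)).mul_const (Real.log (2 / δ))
  rw [zero_mul] at h
  have h2 := h.rpow_const (p := (1 / 4 : ℝ)) (Or.inr (by norm_num))
  rwa [Real.zero_rpow (by norm_num)] at h2

theorem exists_denom_pos {α β : ℝ} (hα : -1 < α) (hβ : -1 < β) (f : ℝ → ℝ) (δ : ℝ) :
    ∃ n₀ : ℕ, ∀ n, n₀ ≤ n → 0 < denom α β f n δ := by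
  have h : Filter.Tendsto (fun n => denom α β f n δ) Filter.atTop
      (nhds (1 / Real.sqrt (gammaConst α β) - 2 * 0 * (supNorm f / weightedNorm α β f))) :=
    (((tendsto_deviation δ).const_mul 2).mul_const _).const_sub _
  have hpos : 0 < 1 / Real.sqrt (gammaConst α β) - 2 * 0 * (supNorm f / weightedNorm α β f) := by
    have := Real.sqrt_pos.2 (gammaConst_pos hα hβ)
    rw [mul_zero, zero_mul, sub_zero]
    positivity
  exact Filter.eventually_atTop.1 (h.eventually (lt_mem_nhds hpos))

theorem denom_le {α β : ℝ} {f : ℝ → ℝ} {δ : ℝ} (hδ : 0 < δ) (hδ1 : δ < 1) (n : ℕ) :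
    denom α β f n δ ≤ 1 / Real.sqrt (gammaConst α β) :=
  sub_le_self _ (mul_nonneg (mul_nonneg two_pos.le (deviation_nonneg hδ hδ1 n))
    (div_nonneg ENNReal.toReal_nonneg ENNReal.toReal_nonneg))

/-- A bandlimited function agrees almost everywhere with a smooth function that is approximated,
at the rate `etaRate`, by polynomials. -/
theorem IsBandlimited.exists_polynomial_approx {c : ℝ} (hc : 0 < c) {g : ℝ → ℂ}
    (hg : IsBandlimited c g) :
    ∃ h : ℝ → ℝ, Continuous h ∧ (∀ᵐ x, (g x).re = h x) ∧ ∀ N : ℕ, ∃ q : Polynomial ℝ,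
      q.natDegree ≤ N ∧ ∀ x ∈ Icc (-1 : ℝ) 1, |h x - q.eval x| ≤ etaRate 1 c N * l2Norm g := by
  obtain ⟨h, hsm, hae, hd⟩ := hg.exists_contDiff hc
  refine ⟨h, hsm.continuous, hae, fun N => ?_⟩
  obtain ⟨q, hq, hb⟩ := exists_polynomial_abs_sub_le N (hsm.of_le (by exact_mod_cast le_top))
    fun t _ => hd (N + 1) t
  refine ⟨q, hq, fun x hx => (hb x hx).trans ?_⟩
  rw [mul_div_right_comm]
  refine mul_le_mul_of_nonneg_right ?_ ENNReal.toReal_nonneg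
  refine le_trans (le_of_eq ?_) (chebyshev_error_le_rate hc N)
  push_cast
  ring_nf

end JacobiRegression

open JacobiRegression in
theorem corollary2 (α : ℝ) (hα : -(1 / 2) ≤ α) :
    ∃ C : ℝ, 0 < C ∧
      ∀ (c : ℝ), 0 < c → ∀ (f : ℝ → ℝ) (fbar : ℝ → ℂ), IsBandlimited c fbar →
        (∀ x ∈ Icc (-1 : ℝ) 1, (f x : ℂ) = fbar x) → weightedNorm α α f ≠ 0 →
      ∀ δ : ℝ, 0 < δ → δ < 1 →
      ∃ n₀ N₀ : ℕ, ∀ n N : ℕ, n₀ ≤ n → N₀ ≤ N → N + 1 ≤ n →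
        0 < denom α α f n δ ∧
        ∀ (Ω : Type*) [MeasurableSpace Ω] (P : Measure Ω) [IsProbabilityMeasure P]
          (X ε : Fin n → Ω → ℝ),
          iIndepFun X P → (∀ i, HasLaw (X i) (betaLaw α α) P) → (∀ i, AEMeasurable (ε i) P) →
          ENNReal.ofReal ((1 - δ) ^ 2) ≤
            P {w | IsUnit (gramMatrix α α N fun i => X i w).det ∧
              weightedNorm α α (fun t =>
                  f t - estimator α α N (fun i => X i w) (fun i => f (X i w) + ε i w) t) ≤
                etaRate C c N * l2Norm fbar +
                  Real.sqrt (2 * condNumber (gramMatrix α α N fun i => X i w)) *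
                    ((deviation n δ + etaRate C c N * l2Norm fbar / Real.sqrt (gammaConst α α) +
                        ⨆ i, |ε i w|) / denom α α f n δ)}
          := by
  have hα1 : -1 < α := by linarith
  set γ := gammaConst α α with hγ
  have hs0 : 0 < Real.sqrt γ := Real.sqrt_pos.2 (gammaConst_pos hα1 hα1)
  -- $\sqrt\gamma$ is the cost of passing from the uniform to the weighted norm, and it cancels the
  -- $1/\sqrt\gamma$ in the numerator.
  refine ⟨Real.sqrt γ, hs0, fun c hc f fbar hband hf _ δ hδ hδ1 => ?_⟩
  obtain ⟨n₀, hn₀⟩ := exists_denom_pos hα1 hα1 f δ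
  obtain ⟨h, hhc, hhae, happ⟩ := hband.exists_polynomial_approx hc
  have hfh : ∀ᵐ x ∂(volume.restrict (Icc (-1 : ℝ) 1)), f x = h x := by
    filter_upwards [ae_restrict_mem measurableSet_Icc, ae_restrict_of_ae hhae] with x hx hxh
    rw [← hxh, ← hf x hx, Complex.ofReal_re]
  -- The approximation bound holds for every $N$, so $N_0=0$; $n_0$ only secures a positive
  -- denominator.
  refine ⟨n₀, 0, fun n N hn _ hNn => ⟨hn₀ n hn, fun Ω _ P _ X ε hind hlaw _ => ?_⟩⟩
  obtain ⟨q, hq, hK⟩ := happ N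
  have hn0 : 0 < n := by omega
  have : Nonempty (Fin n) := ⟨⟨0, hn0⟩⟩
  have hI : ∀ᵐ w ∂P, ∀ i, X i w ∈ Icc (-1 : ℝ) 1 := ae_all_iff.2 fun i =>
    ae_of_hasLaw_betaLaw (hlaw i) (ae_restrict_mem measurableSet_Icc)
  have hfX : ∀ᵐ w ∂P, ∀ i, f (X i w) = h (X i w) := ae_all_iff.2 fun i =>
    ae_of_hasLaw_betaLaw (hlaw i) hfh
  have hδ2 : (1 - δ) ^ 2 ≤ 1 := pow_le_one₀ (by linarith) (by linarith)
  -- Since $(1-\delta)^2\le1$, it suffices that the event has full measure.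
  refine (ENNReal.ofReal_le_one.2 hδ2).trans ?_
  rw [← measure_univ (μ := P)]
  refine measure_mono_ae ?_
  filter_upwards [ae_injective_of_iIndepFun hind hlaw, hI, hfX] with w hinj hIw hfw _
  have hdet : IsUnit (gramMatrix α α N fun i => X i w).det :=
    isUnit_det_gramMatrix hα1 hα1 hNn hinj
  refine ⟨hdet, ?_⟩
  set κ := condNumber (gramMatrix α α N fun i => X i w)
  set E := ⨆ i, |ε i w|
  set e := etaRate 1 c N * l2Norm fbar
  -- Finiteness of the range matters: a real supremum of an unbounded family has a default value.
  have hE : ∀ i, |ε i w| ≤ E := fun i => 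
    le_ciSup (f := fun i => |ε i w|) (Set.finite_range _).bddAbove i
  have hE0 : 0 ≤ E := (abs_nonneg _).trans (hE ⟨0, hn0⟩)
  have he0 : 0 ≤ e := (abs_nonneg _).trans (hK 0 (by norm_num))
  have heta : etaRate (Real.sqrt γ) c N * l2Norm fbar = Real.sqrt γ * e := by
    simp only [e, etaRate]; ring
  have hcongr : weightedNorm α α (fun t =>
      f t - estimator α α N (fun i => X i w) (fun i => f (X i w) + ε i w) t) =
      weightedNorm α α (fun t =>
        h t - estimator α α N (fun i => X i w) (fun i => h (X i w) + ε i w) t) := by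
    simp only [hfw]
    rw [weightedNorm, weightedNorm]
    congr 1
    refine eLpNorm_congr_ae ?_
    filter_upwards [(weightMeasure_absolutelyContinuous α α).ae_le hfh] with t ht
    rw [ht]
  rw [hcongr, heta, mul_div_cancel_left₀ _ hs0.ne']
  refine (weightedNorm_sub_estimator_le hα1 hα1 hn0 hdet hIw hhc hq hK hE).trans ?_
  refine add_le_add_right ?_ _
  have hκ0 : 0 ≤ κ := mul_nonneg (norm_nonneg _) (norm_nonneg _)
  have hD0 := hn₀ n hn
  have hdev := deviation_nonneg hδ hδ1 n
  -- The slack lies in $\kappa_2\le2\kappa_2$, in the nonnegative deviation term of the numerator,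
  -- and in the denominator being at most $1/\sqrt\gamma$.
  refine mul_le_mul (Real.sqrt_le_sqrt (by linarith)) ?_ (by positivity) (Real.sqrt_nonneg _)
  rw [le_div_iff₀ hD0]
  calc Real.sqrt γ * (e + E) * denom α α f n δ
      ≤ Real.sqrt γ * (e + E) * (1 / Real.sqrt γ) :=
        mul_le_mul_of_nonneg_left (denom_le hδ hδ1 n) (by positivity)
    _ = e + E := by field_simp
    _ ≤ _ := by linarith
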